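/- Let $k \ge 2$ be an integer and let $c > 0$ be a real number. For a set $\mathcal{A} \subseteq \mathbb{N}_0$ of non-negative integers and $n \in \mathbb{N}_0$ put $$r^{\leq}_k(\mathcal{A},n) = \#\{(a_1,\dots,a_k)\in\mathcal{A}^k : a_1\le\dots\le a_k,\ a_1+\dots+a_k=n\},$$ $$r^{<}_k(\mathcal{A},n) = \#\{(a_1,\dots,a_k)\in\mathcal{A}^k : a_1<\dots<a_k,\ a_1+\dots+a_k=n\}.$$ Let $\star\in\{\leq,<\}$. Then there does not exist any set $\mathcal{A}\subseteq\mathbb{N}_0$ such that, as $n\to\infty$, $$\sum_{j=0}^{n}\left(r^{\star}_k(\mathcal{A},j)-c\right)=o\left(n^{1/4}\log^{-1/2} n\right).$$ -/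

import Mathlib

open Filter Asymptotics

/-- `r^≤_k(A, n)`: the number of `k`-tuples `a_1 ≤ ... ≤ a_k` of elements of `A` with sum `n`. -/
noncomputable def repLe (k : ℕ) (A : Set ℕ) (n : ℕ) : ℕ :=
  Set.ncard {a : Fin k → ℕ | (∀ i, a i ∈ A) ∧ Monotone a ∧ ∑ i, a i = n}

/-- `r^<_k(A, n)`: the number of `k`-tuples `a_1 < ... < a_k` of elements of `A` with sum `n`. -/
noncomputable def repLt (k : ℕ) (A : Set ℕ) (n : ℕ) : ℕ :=
  Set.ncard {a : Fin k → ℕ | (∀ i, a i ∈ A) ∧ StrictMono a ∧ ∑ i, a i = n}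

/-- There are only finitely many tuples with a given sum, so the cardinalities above are
genuine. -/
theorem finite_tuples_sum (k n : ℕ) : {a : Fin k → ℕ | ∑ i, a i = n}.Finite := by
  refine (Set.finite_Iic (fun _ : Fin k => n)).subset ?_
  intro a ha i
  have h : ∑ i, a i = n := ha
  rw [← h]
  exact Finset.single_le_sum (fun j _ => Nat.zero_le (a j)) (Finset.mem_univ i)

/-! This is an Erdős–Fuchs argument with a kernel. Let f(z) be the sum of z^a over a in A, and let R
be the generating function of the ordered representation counts. R is the k-th elementary (strict
case) or complete homogeneous (weak case) symmetric function of the z^a. By Newton's identities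
k!·R(z) = f(z)^k up to terms of degree at most k-1 in the values f(z^l), l ≤ k. Hence |f(z)|^k ≤
k!|R(z)| + θ Σ_l |f(z^l)|^k + D with θ as small as desired (`norm_genFun_pow_le`). Summation by
parts gives R(z) = c/(1-z) + (1-z)S(z), where S has the error sums s n as coefficients.

Put N = m^4, r = 1 - 1/N, ℓ = log m, and average |f(z)|^k over |z| = r against |1 + z + ⋯ +
z^(M-1)|². Upper bound: the pole contributes M²ℓ. In the other part one kernel factor cancels 1-z,
and Parseval applied to S leaves λM + Q/λ, where Q = Σ s(n)² r^(2n) is o(N^(3/2)/ℓ) by hypothesis.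
The same estimate at z^i costs only a factor i, so the terms f(z^l) are removed by iterating over i
↦ il (`kernelMean_le_of_step`). Lower bound: the coefficients of (1 + ⋯ + z^(M-1))f(z) are
non-negative integers v, so v² ≥ v. Parseval then bounds the mean of |f|² below by about M·f(r²),
and convexity passes to the k-th power (`pow_mul_le_kernelMean`). Since f(r²)^k ≥ R(r²) ≫ N, the
average is ≫ N^(1/2)·M. With M about δN^(1/2)/ℓ and λ = δN^(1/2), the upper bound is a small
multiple of N^(1/2)·M, a contradiction. -/

/-! ### Increasing tuples and their generating polynomials -/

/-- Tuples whose entries satisfy `a i < a j + e` for `i < j`: strictly increasing for `e = 0`,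
weakly increasing for `e = 1`. -/
def IncTuple (e : ℕ) {k : ℕ} (a : Fin k → ℕ) : Prop := ∀ ⦃i j⦄, i < j → a i < a j + e

/-- The number of `IncTuple e` tuples in `A` with sum `n`. -/
noncomputable def repInc (e k : ℕ) (A : Set ℕ) (n : ℕ) : ℕ :=
  Set.ncard {a : Fin k → ℕ | (∀ i, a i ∈ A) ∧ IncTuple e a ∧ ∑ i, a i = n}

theorem repLe_eq_repInc (k : ℕ) (A : Set ℕ) (n : ℕ) : repLe k A n = repInc 1 k A n := by
  unfold repLe repInc IncTuple
  simp only [monotone_iff_forall_lt, Nat.lt_add_one_iff]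

theorem repLt_eq_repInc (k : ℕ) (A : Set ℕ) (n : ℕ) : repLt k A n = repInc 0 k A n := by
  unfold repLt repInc IncTuple StrictMono
  simp only [add_zero]

open Classical in
/-- Increasing tuples in `A` with entries below `N`. -/
noncomputable def incFinset (e k : ℕ) (A : Set ℕ) (N : ℕ) : Finset (Fin k → ℕ) :=
  (Fintype.piFinset fun _ : Fin k => (Finset.range N).filter (· ∈ A)).filter (IncTuple e)

theorem mem_incFinset {e k : ℕ} {A : Set ℕ} {N : ℕ} {a : Fin k → ℕ} :
    a ∈ incFinset e k A N ↔ (∀ i, a i < N ∧ a i ∈ A) ∧ IncTuple e a := by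
  classical
  simp [incFinset]

/-- The generating polynomial of increasing tuples with entries below `N`. -/
noncomputable def incSum (e k : ℕ) (A : Set ℕ) (z : ℂ) (N : ℕ) : ℂ :=
  ∑ a ∈ incFinset e k A N, z ^ ∑ i, a i

open Classical in
/-- The contribution `z ^ n` of a single element of `A`. -/
noncomputable def term (A : Set ℕ) (z : ℂ) (n : ℕ) : ℂ := if n ∈ A then z ^ n else 0

theorem incSum_zero (e : ℕ) (A : Set ℕ) (z : ℂ) (N : ℕ) : incSum e 0 A z N = 1 := by
  have : incFinset e 0 A N = {Fin.elim0} := by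
    ext a
    rw [mem_incFinset]
    simp only [Finset.mem_singleton]
    exact ⟨fun _ => Subsingleton.elim _ _, fun _ => ⟨fun i => i.elim0, fun i => i.elim0⟩⟩
  simp [incSum, this]

theorem incSum_succ_zero (e k : ℕ) (A : Set ℕ) (z : ℂ) : incSum e (k + 1) A z 0 = 0 := by
  have : incFinset e (k + 1) A 0 = ∅ := by
    ext a
    rw [mem_incFinset]
    simp
  simp [incSum, this]

theorem incTuple_snoc {e k : ℕ} {b : Fin k → ℕ} {x : ℕ} :
    IncTuple e (Fin.snoc b x : Fin (k + 1) → ℕ) ↔ IncTuple e b ∧ ∀ i, b i < x + e := by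
  constructor
  · intro h
    refine ⟨fun i j hij => ?_, fun i => ?_⟩
    · have := @h i.castSucc j.castSucc (by simpa using hij)
      simpa using this
    · have := @h i.castSucc (Fin.last k) (Fin.castSucc_lt_last i)
      simpa using this
  · rintro ⟨h1, h2⟩ i j hij
    induction j using Fin.lastCases with
    | last =>
      induction i using Fin.lastCases with
      | last => exact absurd hij (lt_irrefl _)
      | cast i => simpa using h2 i
    | cast j =>
      induction i using Fin.lastCases with
      | last => exact absurd (hij.trans (Fin.castSucc_lt_last j)) (lt_irrefl _)
      | cast i => simpa using h1 (by simpa using hij)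

/-- Split according to whether the last, largest entry equals N. If it does, deleting it leaves a
k-tuple with entries below N + e. For e = 0 this is multiplication by 1 + xX, for e = 1 division by
1 - xX, where x is the term of N. -/
theorem incSum_succ_succ {e : ℕ} (he : e ≤ 1) (k : ℕ) (A : Set ℕ) (z : ℂ) (N : ℕ) :
    incSum e (k + 1) A z (N + 1) =
      incSum e (k + 1) A z N + term A z N * incSum e k A z (N + e) := by
  classical
  unfold incSum
  rw [← Finset.sum_filter_add_sum_filter_not (incFinset e (k + 1) A (N + 1))
    (fun a => a (Fin.last k) ≠ N)]
  congr 1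
  · refine Finset.sum_congr ?_ fun _ _ => rfl
    ext a
    simp only [Finset.mem_filter, mem_incFinset]
    constructor
    · rintro ⟨⟨h1, h2⟩, h3⟩
      refine ⟨fun i => ⟨?_, (h1 i).2⟩, h2⟩
      have hl := (h1 (Fin.last k)).1
      rcases (Fin.le_last i).lt_or_eq with h | h
      · have := h2 h
        omega
      · subst h
        omega
    · rintro ⟨h1, h2⟩
      exact ⟨⟨fun i => ⟨(h1 i).1.trans (Nat.lt_succ_self N), (h1 i).2⟩, h2⟩, (h1 _).1.ne⟩
  · by_cases hN : N ∈ A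
    · rw [term, if_pos hN, Finset.mul_sum]
      symm
      refine Finset.sum_bij' (fun b _ => (Fin.snoc b N : Fin (k + 1) → ℕ))
        (fun a _ => Fin.init a) ?_ ?_ ?_ ?_ ?_
      · intro b hb
        rw [mem_incFinset] at hb
        simp only [Finset.mem_filter, mem_incFinset, incTuple_snoc, Fin.snoc_last, ne_eq,
          not_true_eq_false, not_false_eq_true, and_true]
        refine ⟨fun i => ?_, hb.2, fun i => (hb.1 i).1⟩
        induction i using Fin.lastCases with
        | last => simpa using hN
        | cast i =>
          have := hb.1 i
          simp only [Fin.snoc_castSucc]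
          exact ⟨by omega, this.2⟩
      · intro a ha
        simp only [Finset.mem_filter, mem_incFinset, ne_eq, not_not] at ha
        obtain ⟨⟨h1, h2⟩, h3⟩ := ha
        rw [← Fin.snoc_init_self a, incTuple_snoc, h3] at h2
        exact mem_incFinset.2 ⟨fun i => ⟨h2.2 i, (h1 i.castSucc).2⟩, h2.1⟩
      · intro b _
        exact Fin.init_snoc _ _
      · intro a ha
        simp only [Finset.mem_filter, ne_eq, not_not] at ha
        have := Fin.snoc_init_self a
        rw [ha.2] at this
        exact this
      · intro b _
        rw [Fin.sum_univ_castSucc]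
        simp [pow_add, mul_comm]
    · rw [term, if_neg hN, zero_mul]
      refine Finset.sum_eq_zero fun a ha => ?_
      simp only [Finset.mem_filter, mem_incFinset, ne_eq, not_not] at ha
      exact absurd (ha.2 ▸ (ha.1.1 (Fin.last k)).2) hN

/-! ### Newton's identities -/

/-- Truncated power sums `∑ a ∈ A, a < N, (z ^ a) ^ i`, for `i ≥ 1`. -/
noncomputable def powSum (A : Set ℕ) (z : ℂ) (i N : ℕ) : ℂ :=
  ∑ n ∈ Finset.range N, term A z n ^ i

/-- Coefficientwise form of E' = P·E, the logarithmic derivative of E = ∏(1 + xX). It is proved one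
factor at a time, by induction on N. -/
theorem newton_incSum_strict (A : Set ℕ) (z : ℂ) (N j : ℕ) :
    ((j : ℂ) + 1) * incSum 0 (j + 1) A z N = ∑ q ∈ Finset.HasAntidiagonal.antidiagonal j,
      ((-1) ^ q.1 * powSum A z (q.1 + 1) N) * incSum 0 q.2 A z N := by
  let E : ℕ → PowerSeries ℂ := fun N => PowerSeries.mk fun j => incSum 0 j A z N
  let P : ℕ → PowerSeries ℂ := fun N => PowerSeries.mk fun i => (-1) ^ i * powSum A z (i + 1) N
  suffices h : PowerSeries.derivative ℂ (E N) = P N * E N by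
    have := congrArg (PowerSeries.coeff j) h
    rw [PowerSeries.coeff_derivative, PowerSeries.coeff_mul] at this
    simpa [E, P, mul_comm] using this
  induction N with
  | zero =>
    have : E 0 = 1 := by
      ext j
      rcases j with _ | j
      · simp [E, incSum_zero]
      · simp [E, incSum_succ_zero, PowerSeries.coeff_one]
    have hP : P 0 = 0 := by
      ext i
      simp [P, powSum]
    rw [this, hP]
    simp
  | succ N ih =>
    set x := term A z N with hx
    -- G is the inverse of the new factor 1 + xX, so x·G is that factor's logarithmic derivative.
    let G : PowerSeries ℂ := PowerSeries.mk fun i => (-x) ^ i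
    have hG : G * (1 + PowerSeries.C x * PowerSeries.X) = 1 := by
      ext i
      rcases i with _ | i
      · simp [G]
      · rw [mul_add, mul_one, mul_left_comm, map_add, PowerSeries.coeff_C_mul,
          PowerSeries.coeff_succ_mul_X]
        simp [G, PowerSeries.coeff_one, pow_succ]
        ring
    have hE : E (N + 1) = E N * (1 + PowerSeries.C x * PowerSeries.X) := by
      ext i
      rcases i with _ | i
      · simp [E, incSum_zero]
      · rw [mul_add, mul_one, mul_left_comm, map_add, PowerSeries.coeff_C_mul,
          PowerSeries.coeff_succ_mul_X]
        simp [E, incSum_succ_succ zero_le_one, hx]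
    have hP : P (N + 1) = P N + PowerSeries.C x * G := by
      ext i
      simp only [P, G, map_add, PowerSeries.coeff_mk, PowerSeries.coeff_C_mul, powSum,
        Finset.sum_range_succ, ← hx]
      rw [neg_pow x]
      ring
    have hD : PowerSeries.derivative ℂ (1 + PowerSeries.C x * PowerSeries.X)
        = PowerSeries.C x := by
      ext i
      rw [PowerSeries.coeff_derivative]
      rcases i with _ | i <;>
      simp [PowerSeries.coeff_C, PowerSeries.coeff_one]
    rw [hE, Derivation.leibniz, ih, hD, hP]
    simp only [smul_eq_mul]
    linear_combination (-PowerSeries.C x * E N) * hG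

/-- The same argument for E = ∏ 1/(1 - xX), so no signs appear. -/
theorem newton_incSum_weak (A : Set ℕ) (z : ℂ) (N j : ℕ) :
    ((j : ℂ) + 1) * incSum 1 (j + 1) A z N = ∑ q ∈ Finset.HasAntidiagonal.antidiagonal j,
      powSum A z (q.1 + 1) N * incSum 1 q.2 A z N := by
  let E : ℕ → PowerSeries ℂ := fun N => PowerSeries.mk fun j => incSum 1 j A z N
  let P : ℕ → PowerSeries ℂ := fun N => PowerSeries.mk fun i => powSum A z (i + 1) N
  suffices h : PowerSeries.derivative ℂ (E N) = P N * E N by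
    have := congrArg (PowerSeries.coeff j) h
    rw [PowerSeries.coeff_derivative, PowerSeries.coeff_mul] at this
    simpa [E, P, mul_comm] using this
  induction N with
  | zero =>
    have : E 0 = 1 := by
      ext j
      rcases j with _ | j
      · simp [E, incSum_zero]
      · simp [E, incSum_succ_zero, PowerSeries.coeff_one]
    have hP : P 0 = 0 := by
      ext i
      simp [P, powSum]
    rw [this, hP]
    simp
  | succ N ih =>
    set x := term A z N with hx
    let G : PowerSeries ℂ := PowerSeries.mk fun i => x ^ i
    have hG : G * (1 - PowerSeries.C x * PowerSeries.X) = 1 := by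
      ext i
      rcases i with _ | i
      · simp [G]
      · rw [mul_sub, mul_one, mul_left_comm, map_sub, PowerSeries.coeff_C_mul,
          PowerSeries.coeff_succ_mul_X]
        simp [G, PowerSeries.coeff_one, pow_succ]
        ring
    have hE : E N = E (N + 1) * (1 - PowerSeries.C x * PowerSeries.X) := by
      ext i
      rcases i with _ | i
      · simp [E, incSum_zero]
      · rw [mul_sub, mul_one, mul_left_comm, map_sub, PowerSeries.coeff_C_mul,
          PowerSeries.coeff_succ_mul_X]
        simp [E, incSum_succ_succ le_rfl, hx]
    have hP : P (N + 1) = P N + PowerSeries.C x * G := by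
      ext i
      simp only [P, G, map_add, PowerSeries.coeff_mk, PowerSeries.coeff_C_mul, powSum,
        Finset.sum_range_succ, ← hx]
      ring
    have hD : PowerSeries.derivative ℂ (1 - PowerSeries.C x * PowerSeries.X)
        = -PowerSeries.C x := by
      ext i
      rw [PowerSeries.coeff_derivative]
      rcases i with _ | i <;>
      simp [PowerSeries.coeff_C, PowerSeries.coeff_one]
    rw [hE, Derivation.leibniz, hD] at ih
    simp only [smul_eq_mul] at ih
    rw [hP]
    linear_combination G * ih + (P N * E (N + 1) - PowerSeries.derivative ℂ (E (N+1))) * hG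

/-! ### Size estimates from a Newton recurrence -/

/-- Sequences satisfying a Newton-type recurrence are close to a pure power. -/
theorem norm_le_of_newton {w p : ℕ → ℂ} {g : ℝ} {k : ℕ} (h0 : w 0 = 1) (hg : 1 ≤ g)
    (hp : ∀ i < k, ‖p i‖ ≤ g)
    (hw : ∀ j : ℕ, ((j : ℂ) + 1) * w (j + 1) = ∑ q ∈ Finset.HasAntidiagonal.antidiagonal j, p q.1 * w q.2) :
    ∀ j ≤ k, ‖w j‖ ≤ g ^ j := by
  intro j
  induction j using Nat.strong_induction_on with
  | _ j ih =>
    intro hj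
    rcases j with _ | j
    · simp [h0]
    · have h1 : ‖((j : ℂ) + 1) * w (j + 1)‖ ≤ (j + 1) * g ^ (j + 1) := by
        rw [hw j]
        refine (norm_sum_le _ _).trans ?_
        refine (Finset.sum_le_card_nsmul _ _ (g ^ (j + 1)) fun q hq => ?_).trans ?_
        · rw [Finset.HasAntidiagonal.mem_antidiagonal] at hq
          rw [norm_mul, pow_succ']
          refine mul_le_mul (hp _ (by omega)) ?_ (norm_nonneg _) (by linarith)
          exact (ih q.2 (by omega) (by omega)).trans (pow_le_pow_right₀ hg (by omega))
        · simp
      rw [norm_mul] at h1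
      have h2 : ‖(j : ℂ) + 1‖ = j + 1 := by
        rw [← Nat.cast_add_one, Complex.norm_natCast]
        push_cast
        rfl
      rw [h2] at h1
      exact le_of_mul_le_mul_left h1 (by positivity)

/-- In the recurrence only the term p 0 · w j reproduces the pure power. Every other term has the
form p (i+1) · w (j-1-i), one degree lower in g, so the total error stays of degree j. -/
theorem norm_factorial_mul_sub_pow_le {w p : ℕ → ℂ} {g : ℝ} {k : ℕ} (h0 : w 0 = 1) (hg : 1 ≤ g)
    (hp : ∀ i < k, ‖p i‖ ≤ g)
    (hw : ∀ j : ℕ, ((j : ℂ) + 1) * w (j + 1) = ∑ q ∈ Finset.HasAntidiagonal.antidiagonal j, p q.1 * w q.2) :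
    ∀ j < k, ‖((j + 1).factorial : ℂ) * w (j + 1) - p 0 ^ (j + 1)‖
      ≤ (j + 1).factorial * g ^ j := by
  intro j
  induction j with
  | zero =>
    intro _
    have := hw 0
    simp [h0] at this
    simp [this]
  | succ j ih =>
    intro hj
    have hwn := norm_le_of_newton h0 hg hp hw
    have h1 := hw (j + 1)
    -- Peel off the pair with first entry 0, which carries the main term; T collects the rest.
    rw [Finset.Nat.antidiagonal_succ, Finset.sum_cons, Finset.sum_map] at h1
    simp only [Function.Embedding.prodMap, Function.Embedding.coeFn_mk, Prod.map,
      Nat.succ_eq_add_one, Function.Embedding.refl_apply] at h1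
    set T := ∑ q ∈ Finset.HasAntidiagonal.antidiagonal j, p (q.1 + 1) * w q.2 with hT
    have hTn : ‖T‖ ≤ (j + 1) * g ^ (j + 1) := by
      refine (norm_sum_le _ _).trans ?_
      refine (Finset.sum_le_card_nsmul _ _ (g ^ (j + 1)) fun q hq => ?_).trans ?_
      · rw [Finset.HasAntidiagonal.mem_antidiagonal] at hq
        rw [norm_mul, pow_succ']
        refine mul_le_mul (hp _ (by omega)) ?_ (norm_nonneg _) (by linarith)
        exact (hwn q.2 (by omega)).trans (pow_le_pow_right₀ hg (by omega))
      · simp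
    have e : ((j + 1 + 1).factorial : ℂ) * w (j + 1 + 1) - p 0 ^ (j + 1 + 1)
        = p 0 * (((j + 1).factorial : ℂ) * w (j + 1) - p 0 ^ (j + 1))
          + ((j + 1).factorial : ℂ) * T := by
      rw [Nat.factorial_succ (j + 1)]
      push_cast at h1 ⊢
      linear_combination ((j + 1).factorial : ℂ) * h1
    rw [e]
    refine (norm_add_le _ _).trans ?_
    rw [norm_mul, norm_mul, Complex.norm_natCast]
    have h2 := mul_le_mul (hp 0 (by omega)) (ih (by omega)) (norm_nonneg _) (by linarith)
    have h3 := mul_le_mul_of_nonneg_left hTn (Nat.cast_nonneg (α := ℝ) (j + 1).factorial)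
    rw [Nat.factorial_succ (j + 1)]
    push_cast
    rw [pow_succ g j] at *
    nlinarith

/-! ### From polynomials to generating functions -/

/-- The generating function `∑ a ∈ A, z ^ a`. -/
noncomputable def genFun (A : Set ℕ) (z : ℂ) : ℂ := ∑' n, term A z n

theorem norm_term_le (A : Set ℕ) (z : ℂ) (n : ℕ) : ‖term A z n‖ ≤ ‖z‖ ^ n := by
  unfold term
  split_ifs
  · rw [norm_pow]
  · simp

theorem summable_norm_term (A : Set ℕ) {z : ℂ} (hz : ‖z‖ < 1) :
    Summable fun n => ‖term A z n‖ :=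
  Summable.of_nonneg_of_le (fun _ => norm_nonneg _) (norm_term_le A z)
    (summable_geometric_of_lt_one (norm_nonneg z) hz)

theorem tendsto_powSum (A : Set ℕ) {z : ℂ} (hz : ‖z‖ < 1) {i : ℕ} (hi : i ≠ 0) :
    Tendsto (powSum A z i) atTop (nhds (genFun A (z ^ i))) := by
  have h : ∀ N, powSum A z i N = ∑ n ∈ Finset.range N, term A (z ^ i) n := by
    intro N
    refine Finset.sum_congr rfl fun n _ => ?_
    unfold term
    split_ifs
    · rw [← pow_mul, ← pow_mul, mul_comm]
    · rw [zero_pow hi]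
  have hzi : ‖z ^ i‖ < 1 := by
    rw [norm_pow]
    exact pow_lt_one₀ (norm_nonneg z) hz hi
  rw [show powSum A z i = _ from funext h]
  exact (summable_norm_term A hzi).of_norm.hasSum.tendsto_sum_nat

/-- Dominated convergence: the n-th coefficient of the truncated polynomial never exceeds `repInc e
k A n`, and equals it once N > n, since no entry exceeds the sum. -/
theorem tendsto_incSum (e k : ℕ) (A : Set ℕ) {z : ℂ}
    (hs : Summable fun n => (repInc e k A n : ℝ) * ‖z‖ ^ n) :
    Tendsto (incSum e k A z) atTop (nhds (∑' n, (repInc e k A n : ℂ) * z ^ n)) := by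
  classical
  let cnt : ℕ → ℕ → ℕ := fun N n => ((incFinset e k A N).filter fun a => ∑ i, a i = n).card
  have hle : ∀ N n, cnt N n ≤ repInc e k A n := by
    intro N n
    rw [repInc, show cnt N n = _ from (Set.ncard_coe_finset _).symm]
    refine Set.ncard_le_ncard ?_ ((finite_tuples_sum k n).subset fun a ha => ha.2.2)
    intro a ha
    simp only [Finset.coe_filter, Set.mem_ofPred_eq, mem_incFinset] at ha
    exact ⟨fun i => (ha.1.1 i).2, ha.1.2, ha.2⟩
  have heq : ∀ N n, n < N → cnt N n = repInc e k A n := by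
    intro N n hn
    rw [repInc, show cnt N n = _ from (Set.ncard_coe_finset _).symm]
    congr 1
    ext a
    simp only [Finset.coe_filter, Set.mem_ofPred_eq, mem_incFinset]
    constructor
    · rintro ⟨⟨h1, h2⟩, h3⟩
      exact ⟨fun i => (h1 i).2, h2, h3⟩
    · rintro ⟨h1, h2, h3⟩
      refine ⟨⟨fun i => ⟨lt_of_le_of_lt ?_ hn, h1 i⟩, h2⟩, h3⟩
      rw [← h3]
      exact Finset.single_le_sum (fun j _ => Nat.zero_le (a j)) (Finset.mem_univ i)
  have hsum : ∀ N, incSum e k A z N = ∑' n, (cnt N n : ℂ) * z ^ n := by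
    intro N
    rw [tsum_eq_sum (s := (incFinset e k A N).image fun a => ∑ i, a i)]
    · rw [incSum, ← Finset.sum_fiberwise_of_maps_to (g := fun a => ∑ i, a i)
        (t := (incFinset e k A N).image fun a => ∑ i, a i)
        (fun a ha => Finset.mem_image_of_mem _ ha)]
      refine Finset.sum_congr rfl fun n _ => ?_
      rw [Finset.sum_congr rfl (g := fun _ => z ^ n)]
      · simp [cnt]
      · intro a ha
        rw [(Finset.mem_filter.1 ha).2]
    · intro n hn
      have : cnt N n = 0 := by
        rw [Finset.card_eq_zero, Finset.filter_eq_empty_iff]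
        intro a ha h
        exact hn (Finset.mem_image.2 ⟨a, ha, h⟩)
      simp [this]
  rw [show incSum e k A z = _ from funext hsum]
  refine tendsto_tsum_of_dominated_convergence hs ?_ ?_
  · intro n
    refine tendsto_const_nhds.congr' ?_
    filter_upwards [eventually_gt_atTop n] with N hN
    rw [heq N n hN]
  · refine Eventually.of_forall fun N n => ?_
    rw [norm_mul, norm_pow, Complex.norm_natCast]
    gcongr
    exact hle N n

theorem norm_incSum_sub_le {e : ℕ} (he : e ≤ 1) {k : ℕ} (hk : 1 ≤ k) (A : Set ℕ) (z : ℂ) (N : ℕ) :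
    ‖(k.factorial : ℂ) * incSum e k A z N - powSum A z 1 N ^ k‖ ≤
      k.factorial * (1 + ∑ l ∈ Finset.Icc 1 k, ‖powSum A z l N‖) ^ (k - 1) := by
  set g := 1 + ∑ l ∈ Finset.Icc 1 k, ‖powSum A z l N‖ with hg
  have hg1 : 1 ≤ g := by
    have : 0 ≤ ∑ l ∈ Finset.Icc 1 k, ‖powSum A z l N‖ :=
      Finset.sum_nonneg fun _ _ => norm_nonneg _
    linarith
  have hp : ∀ i < k, ‖powSum A z (i + 1) N‖ ≤ g := by
    intro i hi
    have : ‖powSum A z (i + 1) N‖ ≤ ∑ l ∈ Finset.Icc 1 k, ‖powSum A z l N‖ :=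
      Finset.single_le_sum (f := fun l => ‖powSum A z l N‖) (fun _ _ => norm_nonneg _)
        (Finset.mem_Icc.2 ⟨by omega, by omega⟩)
    linarith
  obtain ⟨j, rfl⟩ : ∃ j, k = j + 1 := ⟨k - 1, by omega⟩
  interval_cases e
  · have := norm_factorial_mul_sub_pow_le (k := j + 1) (w := fun j => incSum 0 j A z N)
      (incSum_zero 0 A z N) hg1 (p := fun i => (-1) ^ i * powSum A z (i + 1) N)
      (fun i hi => by simpa using hp i hi) (newton_incSum_strict A z N) j (Nat.lt_succ_self j)
    simpa using this
  · exact norm_factorial_mul_sub_pow_le (k := j + 1) (w := fun j => incSum 1 j A z N)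
      (incSum_zero 1 A z N) hg1 (p := fun i => powSum A z (i + 1) N)
      hp (newton_incSum_weak A z N) j (Nat.lt_succ_self j)

/-- The generating function of `repInc e k A`. -/
noncomputable def repGen (e k : ℕ) (A : Set ℕ) (z : ℂ) : ℂ := ∑' n, (repInc e k A n : ℂ) * z ^ n

theorem norm_repGen_sub_le {e : ℕ} (he : e ≤ 1) {k : ℕ} (hk : 1 ≤ k) (A : Set ℕ) {z : ℂ}
    (hz : ‖z‖ < 1) (hs : Summable fun n => (repInc e k A n : ℝ) * ‖z‖ ^ n) :
    ‖(k.factorial : ℂ) * repGen e k A z - genFun A z ^ k‖ ≤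
      k.factorial * (1 + ∑ l ∈ Finset.Icc 1 k, ‖genFun A (z ^ l)‖) ^ (k - 1) := by
  have h1 := tendsto_powSum A hz one_ne_zero
  rw [pow_one] at h1
  refine le_of_tendsto_of_tendsto' (((tendsto_incSum e k A hs).const_mul _).sub (h1.pow k)).norm
    (((tendsto_finsetSum _ fun l hl => ?_).const_add _).pow _ |>.const_mul _)
    (norm_incSum_sub_le he hk A z)
  exact (tendsto_powSum A hz (by have := Finset.mem_Icc.1 hl; omega)).norm

/-- Compare x with 1/η. This trades the degree k-1 error for a small multiple of degree k plus a
constant. -/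
theorem pow_pred_le {k : ℕ} (hk : 1 ≤ k) {η x : ℝ} (hη : 0 < η) (hx : 0 ≤ x) :
    x ^ (k - 1) ≤ η * x ^ k + (1 / η) ^ (k - 1) := by
  have hp : 0 ≤ (1 / η) ^ (k - 1) := by positivity
  have hp' : 0 ≤ η * x ^ k := by positivity
  rcases le_total x (1 / η) with h | h
  · have := pow_le_pow_left₀ hx h (k - 1)
    linarith
  · obtain ⟨j, rfl⟩ : ∃ j, k = j + 1 := ⟨k - 1, by omega⟩
    rw [Nat.add_sub_cancel] at *
    have h2 : 1 ≤ η * x := by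
      rwa [div_le_iff₀' hη] at h
    have := mul_le_mul_of_nonneg_right h2 (pow_nonneg hx j)
    rw [pow_succ]
    nlinarith

theorem one_add_sum_pow_le {k : ℕ} (a : ℕ → ℝ) (ha : ∀ l, 0 ≤ a l) :
    (1 + ∑ l ∈ Finset.Icc 1 k, a l) ^ k ≤
      (k + 1) ^ k * (1 + ∑ l ∈ Finset.Icc 1 k, a l ^ k) := by
  have hS : 0 ≤ ∑ l ∈ Finset.Icc 1 k, a l ^ k := Finset.sum_nonneg fun l _ => pow_nonneg (ha l) k
  -- m is the larger of 1 and the maximum of the a l.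
  obtain ⟨m, hm1, hm2, hm3⟩ : ∃ m : ℝ, 1 ≤ m ∧ (∀ l ∈ Finset.Icc 1 k, a l ≤ m) ∧
      m ^ k ≤ 1 + ∑ l ∈ Finset.Icc 1 k, a l ^ k := by
    by_cases h : ∃ l ∈ Finset.Icc 1 k, 1 ≤ a l
    · obtain ⟨l0, hl0, hl1⟩ := h
      obtain ⟨l, hl, hmax⟩ := Finset.exists_max_image (Finset.Icc 1 k) a ⟨l0, hl0⟩
      refine ⟨a l, hl1.trans (hmax l0 hl0), hmax, ?_⟩
      have := Finset.single_le_sum (f := fun l => a l ^ k) (fun l _ => pow_nonneg (ha l) k) hl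
      linarith
    · push Not at h
      exact ⟨1, le_rfl, fun l hl => (h l hl).le, by simpa using hS⟩
  have h1 : 1 + ∑ l ∈ Finset.Icc 1 k, a l ≤ (k + 1) * m := by
    have := Finset.sum_le_card_nsmul _ _ m hm2
    simp at this
    linarith
  have h0 : 0 ≤ ∑ l ∈ Finset.Icc 1 k, a l := Finset.sum_nonneg fun l _ => ha l
  calc _ ≤ ((k + 1) * m) ^ k := pow_le_pow_left₀ (by linarith) h1 k
    _ = (k + 1) ^ k * m ^ k := mul_pow _ _ _
    _ ≤ _ := by gcongr

/-- The central pointwise inequality, from Newton's identities and `pow_pred_le`. D does not depend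
on z, and θ is free, so the sum over l (which includes l = 1) can later be absorbed. -/
theorem norm_genFun_pow_le {e : ℕ} (he : e ≤ 1) {k : ℕ} (hk : 1 ≤ k) (A : Set ℕ)
    (hs : ∀ r : ℝ, 0 ≤ r → r < 1 → Summable fun n => (repInc e k A n : ℝ) * r ^ n)
    {θ : ℝ} (hθ : 0 < θ) :
    ∃ D : ℝ, 0 ≤ D ∧ ∀ z : ℂ, ‖z‖ < 1 → ‖genFun A z‖ ^ k ≤ k.factorial * ‖repGen e k A z‖ +
      θ * ∑ l ∈ Finset.Icc 1 k, ‖genFun A (z ^ l)‖ ^ k + D := by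
  have hK : (0 : ℝ) < k.factorial * (k + 1) ^ k := by positivity
  set K : ℝ := k.factorial * (k + 1) ^ k with hKdef
  refine ⟨θ + k.factorial * (1 / (θ / K)) ^ (k - 1), by positivity, fun z hz => ?_⟩
  have h1 := norm_repGen_sub_le he hk A hz (hs _ (norm_nonneg z) hz)
  set g := 1 + ∑ l ∈ Finset.Icc 1 k, ‖genFun A (z ^ l)‖ with hg
  have hg0 : 0 ≤ g := by
    have : 0 ≤ ∑ l ∈ Finset.Icc 1 k, ‖genFun A (z ^ l)‖ :=
      Finset.sum_nonneg fun _ _ => norm_nonneg _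
    linarith
  have h2 := pow_pred_le hk (div_pos hθ hK) hg0
  have h3 := one_add_sum_pow_le (k := k) (fun l => ‖genFun A (z ^ l)‖) fun _ => norm_nonneg _
  rw [← hg] at h3
  have h4 : ‖genFun A z‖ ^ k ≤ k.factorial * ‖repGen e k A z‖ +
      ‖(k.factorial : ℂ) * repGen e k A z - genFun A z ^ k‖ := by
    rw [← norm_pow, norm_sub_rev]
    have := norm_le_norm_add_norm_sub' (genFun A z ^ k) ((k.factorial : ℂ) * repGen e k A z)
    rwa [norm_mul, Complex.norm_natCast] at this
  have h5 : k.factorial * (θ / K * g ^ k) ≤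
      θ * (1 + ∑ l ∈ Finset.Icc 1 k, ‖genFun A (z ^ l)‖ ^ k) := by
    calc k.factorial * (θ / K * g ^ k) ≤ k.factorial * (θ / K * ((k + 1) ^ k *
          (1 + ∑ l ∈ Finset.Icc 1 k, ‖genFun A (z ^ l)‖ ^ k))) := by gcongr
      _ = θ / K * K * (1 + ∑ l ∈ Finset.Icc 1 k, ‖genFun A (z ^ l)‖ ^ k) := by
        rw [hKdef]; ring
      _ = _ := by rw [div_mul_cancel₀ _ hK.ne']
  have h6 := mul_le_mul_of_nonneg_left h2 (Nat.cast_nonneg (α := ℝ) k.factorial)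
  rw [mul_add] at h6
  linarith

/-- At a real point x ≥ 0 all terms are non-negative, and increasing tuples are among all tuples
counted by the k-th power. -/
theorem norm_incSum_le (e k : ℕ) (A : Set ℕ) {x : ℝ} (hx : 0 ≤ x) (N : ℕ) :
    ‖incSum e k A x N‖ ≤ ‖powSum A x 1 N‖ ^ k := by
  classical
  have h1 : powSum A x 1 N = ((∑ n ∈ (Finset.range N).filter (· ∈ A), x ^ n : ℝ) : ℂ) := by
    rw [Finset.sum_filter]
    push_cast
    refine Finset.sum_congr rfl fun n _ => ?_
    unfold term
    split_ifs <;> simp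
  have h2 : incSum e k A x N = ((∑ a ∈ incFinset e k A N, x ^ ∑ i, a i : ℝ) : ℂ) := by
    simp [incSum]
  rw [h1, h2, Complex.norm_real, Complex.norm_real, Real.norm_of_nonneg (by positivity),
    Real.norm_of_nonneg (by positivity)]
  have h3 := Finset.prod_univ_sum (fun _ : Fin k => (Finset.range N).filter (· ∈ A))
    (fun _ n => x ^ n)
  rw [Finset.prod_const, Finset.card_univ, Fintype.card_fin] at h3
  rw [h3]
  simp only [Finset.prod_pow_eq_pow_sum]
  exact Finset.sum_le_sum_of_subset_of_nonneg (Finset.filter_subset _ _)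
    fun _ _ _ => pow_nonneg hx _

theorem norm_repGen_le (e k : ℕ) (A : Set ℕ) {x : ℝ} (hx : 0 ≤ x) (hx1 : x < 1)
    (hs : Summable fun n => (repInc e k A n : ℝ) * x ^ n) :
    ‖repGen e k A x‖ ≤ ‖genFun A x‖ ^ k := by
  have hn : ‖(x : ℂ)‖ = x := by rw [Complex.norm_real, Real.norm_of_nonneg hx]
  have h1 := tendsto_powSum A (z := x) (by rwa [hn]) one_ne_zero
  rw [pow_one] at h1
  exact le_of_tendsto_of_tendsto' (tendsto_incSum e k A (by rwa [hn])).norm (h1.norm.pow k)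
    (norm_incSum_le e k A hx)

/-! ### Integration over the circle and Parseval -/

open MeasureTheory AddCircle in
/-- Average over the unit circle, parametrized by `UnitAddCircle`. -/
noncomputable abbrev circleMeasure : Measure UnitAddCircle := haarAddCircle

/-- The point `exp (2πix)` of the unit circle. -/
noncomputable def unitExp (x : UnitAddCircle) : ℂ := AddCircle.toCircle x

@[simp]
theorem norm_unitExp (x : UnitAddCircle) : ‖unitExp x‖ = 1 := Circle.norm_coe _

@[fun_prop]
theorem continuous_unitExp : Continuous unitExp :=
  continuous_induced_dom.comp AddCircle.continuous_toCircle

theorem unitExp_nsmul (n : ℕ) (x : UnitAddCircle) : unitExp (n • x) = unitExp x ^ n := by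
  unfold unitExp
  rw [AddCircle.toCircle_nsmul, Circle.coe_pow]

theorem integrable_of_continuous {E : Type*} [NormedAddCommGroup E]
    {F : UnitAddCircle → E} (hF : Continuous F) : MeasureTheory.Integrable F circleMeasure :=
  hF.integrable_of_hasCompactSupport (HasCompactSupport.of_compactSpace F)

/-- Multiplication by i ≠ 0 preserves Haar measure. This makes means over z^i no harder than means
over z. -/
theorem integral_comp_nsmul {F : UnitAddCircle → ℝ} (hF : Continuous F) {i : ℕ} (hi : i ≠ 0) :
    ∫ x, F (i • x) ∂circleMeasure = ∫ x, F x ∂circleMeasure := by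
  have h := MeasureTheory.Measure.measurePreserving_zsmul circleMeasure
    (Int.natCast_ne_zero.2 hi)
  simp only [natCast_zsmul] at h
  conv_rhs => rw [← h.map_eq]
  rw [MeasureTheory.integral_map h.measurable.aemeasurable
    hF.aestronglyMeasurable]

theorem integral_unitExp_pow_mul_conj (m n : ℕ) :
    ∫ x, unitExp x ^ m * (starRingEnd ℂ) (unitExp x ^ n) ∂circleMeasure
      = if m = n then 1 else 0 := by
  have h := congrFun (fourierCoeff_fourier (T := 1) (m : ℤ)) (n : ℤ)
  rw [fourierCoeff, Pi.single_apply] at h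
  simp only [Nat.cast_inj, eq_comm (a := n)] at h
  rw [← h]
  refine MeasureTheory.integral_congr_ae (Eventually.of_forall fun x => ?_)
  beta_reduce
  rw [fourier_neg, smul_eq_mul, fourier_apply, fourier_apply, natCast_zsmul, natCast_zsmul]
  rw [← unitExp, ← unitExp, unitExp_nsmul, unitExp_nsmul, mul_comm]

theorem integral_norm_sq_tsum {b : ℕ → ℂ} (hb : Summable fun n => ‖b n‖) :
    HasSum (fun n => ‖b n‖ ^ 2) (∫ x, ‖∑' n, b n * unitExp x ^ n‖ ^ 2 ∂circleMeasure) := by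
  set F : UnitAddCircle → ℂ := fun x => ∑' n, b n * unitExp x ^ n with hF
  have hFc : Continuous F := by
    refine continuous_tsum (fun n => by fun_prop) hb fun n x => ?_
    simp
  have hs : ∀ x, HasSum (fun n => b n * unitExp x ^ n) (F x) := fun x =>
    (Summable.of_norm (by simpa using hb)).hasSum
  -- Termwise integration against g, used twice: with g a conjugate monomial to extract b m, then
  -- with g the conjugate of F.
  have key : ∀ g : UnitAddCircle → ℂ, Continuous g → HasSum
      (fun n => b n * ∫ x, unitExp x ^ n * g x ∂circleMeasure) (∫ x, F x * g x ∂circleMeasure) := by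
    intro g hg
    obtain ⟨C, hC⟩ := isCompact_univ.exists_bound_of_continuousOn hg.continuousOn
    have hC' : ∀ x, ‖g x‖ ≤ C := fun x => hC x (Set.mem_univ x)
    have h := MeasureTheory.hasSum_integral_of_summable_integral_norm (μ := circleMeasure)
      (F := fun n x => b n * unitExp x ^ n * g x)
      (fun n => integrable_of_continuous (by fun_prop)) ?_
    · have e1 : ∀ n, b n * ∫ x, unitExp x ^ n * g x ∂circleMeasure
          = ∫ x, b n * unitExp x ^ n * g x ∂circleMeasure := fun n => by
        rw [← MeasureTheory.integral_const_mul]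
        simp only [mul_assoc]
      have e2 : ∀ x, F x * g x = ∑' n, b n * unitExp x ^ n * g x := fun x =>
        ((hs x).mul_right (g x)).tsum_eq.symm
      simp only [e1, e2]
      exact h
    · refine Summable.of_nonneg_of_le (fun n => MeasureTheory.integral_nonneg fun x => norm_nonneg _)
        (fun n => ?_) (hb.mul_right C)
      refine (MeasureTheory.integral_mono (μ := circleMeasure) (g := fun _ => ‖b n‖ * C)
        (integrable_of_continuous (by fun_prop)) (MeasureTheory.integrable_const _) fun x => ?_).trans ?_
      · simp only [norm_mul, norm_pow, norm_unitExp, one_pow, mul_one]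
        exact mul_le_mul_of_nonneg_left (hC' x) (norm_nonneg _)
      · simp
  have h2 : ∀ m, ∫ x, unitExp x ^ m * (starRingEnd ℂ) (F x) ∂circleMeasure
      = (starRingEnd ℂ) (b m) := by
    intro m
    have h3 := key (fun x => (starRingEnd ℂ) (unitExp x ^ m)) (by fun_prop)
    simp only [integral_unitExp_pow_mul_conj] at h3
    have h4 : ∫ x, F x * (starRingEnd ℂ) (unitExp x ^ m) ∂circleMeasure = b m := by
      refine h3.unique ?_
      have := hasSum_single (f := fun n => b n * if n = m then (1 : ℂ) else 0) m
        fun n hn => by rw [if_neg hn, mul_zero]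
      rwa [if_pos rfl, mul_one] at this
    rw [← h4, ← integral_conj]
    simp [mul_comm]
  have h5 := key (fun x => (starRingEnd ℂ) (F x)) (by fun_prop)
  simp only [h2, Complex.mul_conj, Complex.normSq_eq_norm_sq] at h5
  rw [integral_complex_ofReal] at h5
  exact_mod_cast h5

/-! ### Logarithmic bound for the mean of 1/|1 - z| -/

theorem norm_one_sub_le_two_mul {ρ : ℝ} (hρ : 0 ≤ ρ) (hρ1 : ρ ≤ 1) {u : ℂ} (hu : ‖u‖ = 1) :
    ‖1 - u‖ ≤ 2 * ‖1 - ρ * u‖ ∧ 1 - ρ ≤ ‖1 - ρ * u‖ := by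
  have h1 : ‖(ρ : ℂ) * u‖ = ρ := by rw [norm_mul, hu, Complex.norm_real, Real.norm_of_nonneg hρ, mul_one]
  have h2 : 1 - ρ ≤ ‖1 - ρ * u‖ := by
    have := norm_sub_norm_le (1 : ℂ) (ρ * u)
    rwa [norm_one, h1] at this
  refine ⟨?_, h2⟩
  have h3 : ‖(ρ : ℂ) * u - u‖ = 1 - ρ := by
    rw [show (ρ : ℂ) * u - u = ((ρ - 1 : ℝ) : ℂ) * u by push_cast; ring, norm_mul, hu,
      Complex.norm_real, Real.norm_of_nonpos (by linarith)]
    ring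
  have h4 : 1 - u = (1 - ρ * u) + (ρ * u - u) := by ring
  rw [h4]
  refine (norm_add_le _ _).trans ?_
  linarith

theorem four_mul_abs_le_norm_one_sub_unitExp {x : ℝ} (hx : |x| ≤ 1 / 2) :
    4 * |x| ≤ ‖1 - unitExp (x : UnitAddCircle)‖ := by
  have h1 : unitExp (x : UnitAddCircle) = Complex.exp (Complex.I * ((2 * Real.pi * x : ℝ) : ℂ)) := by
    have := fourier_coe_apply (T := 1) (n := 1) (x := x)
    rw [fourier_apply, one_zsmul] at this
    rw [unitExp, this]
    congr 1
    push_cast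
    ring
  rw [h1, norm_sub_rev, Complex.norm_exp_I_mul_ofReal_sub_one]
  have hpi := Real.pi_pos
  have h2 := Real.mul_abs_le_abs_sin (x := 2 * Real.pi * x / 2) (by
    rw [show 2 * Real.pi * x / 2 = Real.pi * x by ring, abs_mul, abs_of_pos hpi]
    nlinarith)
  rw [norm_mul, Real.norm_eq_abs, Real.norm_eq_abs, abs_two]
  rw [show 2 * Real.pi * x / 2 = Real.pi * x by ring, abs_mul Real.pi, abs_of_pos hpi] at h2
  rw [show 2 * Real.pi * x / 2 = Real.pi * x by ring]
  have h3 : 2 / Real.pi * (Real.pi * |x|) = 2 * |x| := by field_simp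
  linarith

theorem integral_two_div (t : ℝ) (ht : 0 < t) :
    ∫ x in (0 : ℝ)..(1 / 2), 2 / (2 * x + t) = Real.log ((1 + t) / t) := by
  have h : ∀ x ∈ Set.uIcc (0 : ℝ) (1 / 2), HasDerivAt (fun x => Real.log (2 * x + t))
      (2 / (2 * x + t)) x := by
    intro x hx
    rw [Set.uIcc_of_le (by norm_num)] at hx
    have h1 : HasDerivAt (fun x : ℝ => 2 * x + t) 2 x := by
      simpa using ((hasDerivAt_id x).const_mul 2).add_const t
    exact h1.log (by have := hx.1; positivity)
  rw [intervalIntegral.integral_eq_sub_of_hasDerivAt h]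
  · rw [Real.log_div (by positivity) ht.ne']
    norm_num
  · refine ContinuousOn.intervalIntegrable fun x hx => ContinuousAt.continuousWithinAt ?_
    rw [Set.uIcc_of_le (by norm_num)] at hx
    have : 2 * x + t ≠ 0 := by have := hx.1; positivity
    fun_prop (disch := exact this)

/-- On |x| ≤ 1/2 the denominator is at least 2|x| and at least t, hence at least half their sum. -/
theorem integral_inv_norm_one_sub_le {ρ t : ℝ} (hρ : 0 ≤ ρ) (ht : 0 < t) (hρt : ρ ≤ 1 - t) :
    ∫ x, 1 / ‖1 - ρ * unitExp x‖ ∂circleMeasure ≤ 2 * Real.log ((1 + t) / t) := by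
  have hlow : ∀ x, 0 < ‖1 - ρ * unitExp x‖ := fun x => by
    have := (norm_one_sub_le_two_mul hρ (by linarith) (norm_unitExp x)).2
    linarith
  rw [AddCircle.integral_haarAddCircle, inv_one, one_smul,
    ← UnitAddCircle.intervalIntegral_preimage (-(1 / 2))]
  have hcont : Continuous fun x : ℝ => 1 / ‖1 - ρ * unitExp (x : UnitAddCircle)‖ := by
    refine Continuous.div continuous_const ?_ fun x => (hlow x).ne'
    have : Continuous fun x : ℝ => unitExp (x : UnitAddCircle) :=
      continuous_unitExp.comp (AddCircle.continuous_mk' 1)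
    fun_prop
  have hcont2 : Continuous fun x : ℝ => 2 / (2 * |x| + t) :=
    Continuous.div continuous_const (by fun_prop) fun x => by positivity
  rw [show (-(1 / 2) + 1 : ℝ) = 1 / 2 by norm_num]
  calc _ ≤ ∫ x in (-(1 / 2) : ℝ)..(1 / 2), 2 / (2 * |x| + t) := by
        refine intervalIntegral.integral_mono_on (by norm_num) (hcont.intervalIntegrable _ _)
          (hcont2.intervalIntegrable _ _) fun x hx => ?_
        have h1 := norm_one_sub_le_two_mul hρ (by linarith) (norm_unitExp x)
        have h2 := four_mul_abs_le_norm_one_sub_unitExp (abs_le.2 hx)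
        rw [div_le_div_iff₀ (hlow x) (by positivity)]
        linarith
    _ = (∫ x in (-(1 / 2) : ℝ)..0, 2 / (2 * |x| + t)) + ∫ x in (0 : ℝ)..(1 / 2), 2 / (2 * |x| + t) :=
        (intervalIntegral.integral_add_adjacent_intervals (hcont2.intervalIntegrable _ _)
          (hcont2.intervalIntegrable _ _)).symm
    _ = 2 * ∫ x in (0 : ℝ)..(1 / 2), 2 / (2 * |x| + t) := by
        have := intervalIntegral.integral_comp_neg (a := 0) (b := 1 / 2)
          (fun x : ℝ => 2 / (2 * |x| + t))
        simp only [abs_neg, neg_zero] at this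
        rw [← this]
        ring
    _ = _ := by
        rw [← integral_two_div t ht]
        congr 1
        refine intervalIntegral.integral_congr fun x hx => ?_
        rw [Set.uIcc_of_le (by norm_num)] at hx
        simp only [abs_of_nonneg hx.1]

/-! ### Window counts and power series with real coefficients -/

/-- The number of ways to write `m = j + a` with `j < M` and `a ∈ A`. -/
noncomputable def windowCount (A : Set ℕ) (M m : ℕ) : ℕ := by
  classical exact ((Finset.range M).filter fun j => j ≤ m ∧ m - j ∈ A).card

theorem hasSum_windowCount (A : Set ℕ) (M : ℕ) {z : ℂ} (hz : ‖z‖ < 1) :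
    HasSum (fun m => (windowCount A M m : ℂ) * z ^ m)
      ((∑ j ∈ Finset.range M, z ^ j) * genFun A z) := by
  classical
  have h1 : ∀ j, HasSum (fun m => if j ≤ m ∧ m - j ∈ A then z ^ m else 0) (z ^ j * genFun A z) := by
    intro j
    have h2 := (summable_norm_term A hz).of_norm.hasSum.mul_left (z ^ j)
    rw [← (add_left_injective j).hasSum_iff]
    · refine h2.congr_fun fun n => ?_
      simp only [Function.comp, Nat.le_add_left, Nat.add_sub_cancel, true_and, term]
      split_ifs
      · rw [pow_add, mul_comm]
      · simp
    · intro m hm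
      rw [if_neg]
      rintro ⟨h3, -⟩
      exact hm ⟨m - j, Nat.sub_add_cancel h3⟩
  rw [Finset.sum_mul]
  refine (hasSum_sum fun j (_ : j ∈ Finset.range M) => h1 j).congr_fun fun m => ?_
  rw [windowCount, ← Finset.sum_filter, Finset.sum_const, nsmul_eq_mul]

/-- The indicator of `A` as a complex sequence. -/
noncomputable def indCoeff (A : Set ℕ) (n : ℕ) : ℂ := by
  classical exact if n ∈ A then 1 else 0

theorem norm_indCoeff_le (A : Set ℕ) (n : ℕ) : ‖indCoeff A n‖ ≤ 1 := by
  unfold indCoeff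
  split_ifs <;> simp

theorem genFun_eq_tsum (A : Set ℕ) (z : ℂ) : genFun A z = ∑' n, indCoeff A n * z ^ n := by
  unfold genFun term indCoeff
  simp

theorem summable_of_linear_bound {a : ℕ → ℂ} {K : ℝ} (ha : ∀ n, ‖a n‖ ≤ K * (n + 1)) {r : ℝ}
    (hr : 0 ≤ r) (hr1 : r < 1) : Summable fun n => ‖a n‖ * r ^ n := by
  have h1 : Summable fun n : ℕ => (n : ℝ) * r ^ n := by
    simpa using summable_pow_mul_geometric_of_norm_lt_one 1 (r := r)
      (by rwa [Real.norm_of_nonneg hr])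
  have h2 := (h1.add (summable_geometric_of_lt_one hr hr1)).mul_left K
  refine Summable.of_nonneg_of_le (fun n => by positivity) (fun n => ?_) h2
  calc _ ≤ K * (n + 1) * r ^ n := by gcongr; exact ha n
    _ = _ := by ring

theorem continuous_powerSeries_comp {a : ℕ → ℂ} {r : ℝ} (ha : Summable fun n => ‖a n‖ * r ^ n)
    {g : UnitAddCircle → ℂ} (hg : Continuous g) (hgr : ∀ x, ‖g x‖ ≤ r) :
    Continuous fun x => ∑' n, a n * g x ^ n := by
  refine continuous_tsum (fun n => by fun_prop) ha fun n x => ?_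
  rw [norm_mul, norm_pow]
  gcongr
  exact hgr x

section
variable {s : ℕ → ℝ} {K : ℝ}

/-- The generating function of a real sequence. -/
noncomputable def seqGen (s : ℕ → ℝ) (z : ℂ) : ℂ := ∑' n, (s n : ℂ) * z ^ n

/-- Summation by parts: ρ n = c + s n - s (n-1), with s (-1) read as 0. -/
theorem hasSum_rep_of_partial_sum {ρ : ℕ → ℝ} {c : ℝ}
    (hs : ∀ n, s n = ∑ j ∈ Finset.range (n + 1), (ρ j - c))
    (hK : ∀ n, |s n| ≤ K * (n + 1)) {z : ℂ} (hz : ‖z‖ < 1) :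
    HasSum (fun n => (ρ n : ℂ) * z ^ n) (c / (1 - z) + (1 - z) * seqGen s z) := by
  have h1 : HasSum (fun n => (s n : ℂ) * z ^ n) (seqGen s z) := by
    refine (Summable.of_norm ?_).hasSum
    have := summable_of_linear_bound (a := fun n => (s n : ℂ)) (K := K) (by simpa using hK)
      (norm_nonneg z) hz
    simpa using this
  have h2 : HasSum (fun n => if n = 0 then 0 else (s (n - 1) : ℂ) * z ^ n) (z * seqGen s z) := by
    rw [← (add_left_injective 1).hasSum_iff]
    · refine (h1.mul_left z).congr_fun fun n => ?_
      simp [pow_succ]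
      ring
    · intro n hn
      rw [if_pos]
      by_contra h
      exact hn ⟨n - 1, by simp; omega⟩
  have h3 := (hasSum_geometric_of_norm_lt_one hz).mul_left (c : ℂ)
  have h4 := (h3.add h1).sub h2
  have e : c / (1 - z) + (1 - z) * seqGen s z = c * (1 - z)⁻¹ + seqGen s z - z * seqGen s z := by
    ring
  rw [e]
  refine h4.congr_fun fun n => ?_
  rcases n with _ | n
  · have := hs 0
    simp at this
    simp [this]
  · have h5 := hs (n + 1)
    rw [Finset.sum_range_succ, ← hs n] at h5
    have : ρ (n + 1) = c + s (n + 1) - s n := by linarith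
    simp [this]
    ring

theorem summable_rep_of_partial_sum {ρ : ℕ → ℝ} {c : ℝ}
    (hs : ∀ n, s n = ∑ j ∈ Finset.range (n + 1), (ρ j - c))
    (hK : ∀ n, |s n| ≤ K * (n + 1)) {r : ℝ} (hr : 0 ≤ r) (hr1 : r < 1) :
    Summable fun n => ρ n * r ^ n := by
  have h := (hasSum_rep_of_partial_sum hs hK (z := r)
    (by rwa [Complex.norm_real, Real.norm_of_nonneg hr])).summable
  exact_mod_cast h

end

/-! ### Estimates for the kernel -/

theorem norm_geomSum_le {z : ℂ} (hz : ‖z‖ ≤ 1) (M : ℕ) : ‖∑ j ∈ Finset.range M, z ^ j‖ ≤ M := by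
  refine (norm_sum_le _ _).trans ?_
  refine (Finset.sum_le_card_nsmul _ _ 1 fun j _ => ?_).trans (by simp)
  rw [norm_pow]
  exact pow_le_one₀ (norm_nonneg z) hz

/-- The factor 1 - z of 1 - z^i telescopes with the kernel to 1 - z^M; the cofactor has i terms. The
bound is independent of M and only linear in i. -/
theorem norm_geomSum_mul_one_sub_pow_le {z : ℂ} (hz : ‖z‖ ≤ 1) (M i : ℕ) :
    ‖∑ j ∈ Finset.range M, z ^ j‖ * ‖1 - z ^ i‖ ≤ 2 * i := by
  have h1 : 1 - z ^ i = (1 - z) * ∑ j ∈ Finset.range i, z ^ j := (mul_neg_geom_sum z i).symm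
  rw [h1, norm_mul, ← mul_assoc, ← norm_mul, geom_sum_mul_neg]
  refine mul_le_mul ?_ (norm_geomSum_le hz i) (norm_nonneg _) zero_le_two
  refine (norm_sub_le _ _).trans ?_
  rw [norm_one, norm_pow]
  have := pow_le_one₀ (norm_nonneg z) hz (n := M)
  linarith

theorem integral_norm_geomSum_sq_le {r : ℝ} (hr : 0 ≤ r) (hr1 : r ≤ 1) (M : ℕ) :
    ∫ x, ‖∑ j ∈ Finset.range M, ((r : ℂ) * unitExp x) ^ j‖ ^ 2 ∂circleMeasure ≤ M := by
  have hfin : ∀ n ∉ Finset.range M, (if n < M then (r : ℂ) ^ n else 0) = 0 := fun n hn =>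
    if_neg (by simpa using hn)
  have h := integral_norm_sq_tsum (b := fun n => if n < M then (r : ℂ) ^ n else 0)
    (summable_of_ne_finset_zero (s := Finset.range M) fun n hn => by
      rw [hfin n hn, norm_zero])
  have e : ∀ x, ∑' n, (if n < M then (r : ℂ) ^ n else 0) * unitExp x ^ n
      = ∑ j ∈ Finset.range M, ((r : ℂ) * unitExp x) ^ j := by
    intro x
    rw [tsum_eq_sum (s := Finset.range M) fun n hn => by rw [hfin n hn, zero_mul]]
    refine Finset.sum_congr rfl fun n hn => ?_
    rw [if_pos (Finset.mem_range.1 hn), mul_pow]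
  simp only [e] at h
  rw [← h.tsum_eq, tsum_eq_sum (s := Finset.range M) fun n hn => by rw [hfin n hn]; simp]
  refine (Finset.sum_le_card_nsmul _ _ 1 fun n hn => ?_).trans (by simp)
  rw [if_pos (Finset.mem_range.1 hn), norm_pow, Complex.norm_real, Real.norm_of_nonneg hr]
  exact pow_le_one₀ (by positivity) (pow_le_one₀ hr hr1)

theorem integral_norm_seqGen_sq_le {s : ℕ → ℝ} {K : ℝ} (hK : ∀ n, |s n| ≤ K * (n + 1)) {r Q : ℝ}
    (hr : 0 ≤ r) (hr1 : r < 1) (hQ : HasSum (fun n => s n ^ 2 * (r ^ 2) ^ n) Q) {i : ℕ}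
    (hi : i ≠ 0) :
    ∫ x, ‖seqGen s (((r : ℂ) * unitExp x) ^ i)‖ ^ 2 ∂circleMeasure ≤ Q := by
  have hri : 0 ≤ r ^ i := by positivity
  have hri1 : r ^ i < 1 := pow_lt_one₀ hr hr1 hi
  have hsum := summable_of_linear_bound (a := fun n => (s n : ℂ)) (K := K) (by simpa using hK)
      hri hri1
  have hc : Continuous fun x => ‖seqGen s (((r ^ i : ℝ) : ℂ) * unitExp x)‖ ^ 2 := by
    have := continuous_powerSeries_comp hsum (g := fun x => ((r ^ i : ℝ) : ℂ) * unitExp x)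
      (by fun_prop) fun x => by
        rw [norm_mul, norm_unitExp, Complex.norm_real, Real.norm_of_nonneg hri, mul_one]
    exact this.norm.pow 2
  have e : ∀ x, ‖seqGen s (((r : ℂ) * unitExp x) ^ i)‖ ^ 2
      = ‖seqGen s (((r ^ i : ℝ) : ℂ) * unitExp (i • x))‖ ^ 2 := fun x => by
    rw [unitExp_nsmul, mul_pow]
    push_cast
    rfl
  simp only [e]
  rw [integral_comp_nsmul hc hi]
  have h := integral_norm_sq_tsum (b := fun n => (s n : ℂ) * ((r ^ i : ℝ) : ℂ) ^ n)
    (by simpa [abs_of_nonneg hr] using hsum)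
  have e2 : ∀ x, seqGen s (((r ^ i : ℝ) : ℂ) * unitExp x)
      = ∑' n, (s n : ℂ) * ((r ^ i : ℝ) : ℂ) ^ n * unitExp x ^ n := fun x => by
    simp only [seqGen, mul_pow, mul_assoc]
  simp only [e2]
  refine hasSum_le (fun n => ?_) h hQ
  rw [norm_mul, norm_pow, Complex.norm_real, Complex.norm_real, Real.norm_of_nonneg hri, mul_pow,
    Real.norm_eq_abs, sq_abs]
  refine mul_le_mul_of_nonneg_left ?_ (sq_nonneg _)
  rw [← pow_mul, mul_comm n 2, pow_mul]
  refine pow_le_pow_left₀ (by positivity) (pow_le_pow_left₀ hri ?_ 2) n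
  exact pow_le_of_le_one hr hr1.le hi

theorem integral_inv_norm_one_sub_pow_le {r : ℝ} (hr : 0 ≤ r) (hr1 : r < 1) {i : ℕ} (hi : i ≠ 0) :
    ∫ x, 1 / ‖1 - ((r : ℂ) * unitExp x) ^ i‖ ∂circleMeasure
      ≤ 2 * Real.log ((2 - r) / (1 - r)) := by
  have hri : 0 ≤ r ^ i := by positivity
  have hri1 : r ^ i ≤ r := pow_le_of_le_one hr hr1.le hi
  have hlow : ∀ x, ‖1 - ((r ^ i : ℝ) : ℂ) * unitExp x‖ ≠ 0 := fun x => by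
    have := (norm_one_sub_le_two_mul hri (by linarith) (norm_unitExp x)).2
    linarith
  have hc : Continuous fun x => 1 / ‖1 - ((r ^ i : ℝ) : ℂ) * unitExp x‖ :=
    Continuous.div continuous_const (by fun_prop) hlow
  have e : ∀ x, 1 / ‖1 - ((r : ℂ) * unitExp x) ^ i‖
      = 1 / ‖1 - ((r ^ i : ℝ) : ℂ) * unitExp (i • x)‖ := fun x => by
    rw [unitExp_nsmul, mul_pow]
    push_cast
    rfl
  simp only [e]
  rw [integral_comp_nsmul hc hi]
  have := integral_inv_norm_one_sub_le hri (t := 1 - r) (by linarith) (by linarith)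
  rwa [show 1 + (1 - r) = 2 - r by ring] at this

/-! ### Upper bound for the weighted mean -/

/-- The weighted mean of `|f(z^i)|^k` against a kernel `|1 + z + ⋯ + z^(M-1)|^2`, `|z| = r`. -/
noncomputable def kernelMean (A : Set ℕ) (k M : ℕ) (r : ℝ) (i : ℕ) : ℝ :=
  ∫ x, ‖∑ j ∈ Finset.range M, ((r : ℂ) * unitExp x) ^ j‖ ^ 2 *
    ‖genFun A (((r : ℂ) * unitExp x) ^ i)‖ ^ k ∂circleMeasure

theorem norm_mul_unitExp {r : ℝ} (hr : 0 ≤ r) (x : UnitAddCircle) : ‖(r : ℂ) * unitExp x‖ = r := by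
  rw [norm_mul, norm_unitExp, Complex.norm_real, Real.norm_of_nonneg hr, mul_one]

theorem continuous_genFun_circle (A : Set ℕ) {r : ℝ} (hr : 0 ≤ r) (hr1 : r < 1) {i : ℕ}
    (hi : i ≠ 0) : Continuous fun x => genFun A (((r : ℂ) * unitExp x) ^ i) := by
  simp only [genFun_eq_tsum]
  refine continuous_powerSeries_comp (r := r) ?_ (by fun_prop) fun x => ?_
  · refine summable_of_linear_bound (K := 1) (fun n => (norm_indCoeff_le A n).trans ?_) hr hr1
    have : (0 : ℝ) ≤ n := n.cast_nonneg
    linarith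
  · rw [norm_pow, norm_mul_unitExp hr]
    exact pow_le_of_le_one hr hr1.le hi

theorem continuous_seqGen_circle {s : ℕ → ℝ} {K : ℝ} (hK : ∀ n, |s n| ≤ K * (n + 1)) {r : ℝ}
    (hr : 0 ≤ r) (hr1 : r < 1) {i : ℕ} (hi : i ≠ 0) :
    Continuous fun x => seqGen s (((r : ℂ) * unitExp x) ^ i) := by
  refine continuous_powerSeries_comp (r := r)
    (summable_of_linear_bound (K := K) (by simpa using hK) hr hr1) (by fun_prop) fun x => ?_
  rw [norm_pow, norm_mul_unitExp hr]
  exact pow_le_of_le_one hr hr1.le hi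

/-- At the pole the kernel is bounded trivially by M². In the other term one kernel factor h absorbs
1 - z^i at cost 2i, and 2hS ≤ λh² + S²/λ leaves two integrals controlled by Parseval. -/
theorem kernelMean_le_step {A : Set ℕ} {k M : ℕ} {c K θ D : ℝ} {G : ℂ → ℂ} {s : ℕ → ℝ}
    (hc : 0 ≤ c) (hD : 0 ≤ D)
    (hK : ∀ n, |s n| ≤ K * (n + 1))
    (hG : ∀ z : ℂ, ‖z‖ < 1 → G z = c / (1 - z) + (1 - z) * seqGen s z)
    (hf : ∀ z : ℂ, ‖z‖ < 1 → ‖genFun A z‖ ^ k ≤ k.factorial * ‖G z‖ +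
      θ * ∑ l ∈ Finset.Icc 1 k, ‖genFun A (z ^ l)‖ ^ k + D)
    {r Q lam : ℝ} (hr : 0 ≤ r) (hr1 : r < 1) (hlam : 0 < lam)
    (hQ : HasSum (fun n => s n ^ 2 * (r ^ 2) ^ n) Q) {i : ℕ} (hi : i ≠ 0) :
    kernelMean A k M r i ≤
      k.factorial * (c * M ^ 2 * (2 * Real.log ((2 - r) / (1 - r))) + i * (lam * M + Q / lam)) +
      θ * ∑ l ∈ Finset.Icc 1 k, kernelMean A k M r (i * l) + D * M := by
  set z : UnitAddCircle → ℂ := fun x => (r : ℂ) * unitExp x with hz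
  have hzc : Continuous z := by fun_prop
  have hzn : ∀ x, ‖z x‖ = r := norm_mul_unitExp hr
  set h : UnitAddCircle → ℝ := fun x => ‖∑ j ∈ Finset.range M, z x ^ j‖ with hh
  have hhc : Continuous h := by fun_prop
  have hzi : ∀ x, ‖z x ^ i‖ < 1 := fun x => by
    rw [norm_pow, hzn]
    exact pow_lt_one₀ hr hr1 hi
  have hne : ∀ x, ‖1 - z x ^ i‖ ≠ 0 := fun x hx => by
    have h1 := hzi x
    rw [norm_eq_zero, sub_eq_zero] at hx
    rw [← hx, norm_one] at h1
    exact lt_irrefl _ h1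
  have hc1 : Continuous fun x => 1 / ‖1 - z x ^ i‖ :=
    Continuous.div continuous_const (by fun_prop) hne
  have hc2 : Continuous fun x => ‖seqGen s (z x ^ i)‖ ^ 2 :=
    (continuous_seqGen_circle hK hr hr1 hi).norm.pow 2
  have hc3 : ∀ j ≠ 0, Continuous fun x => h x ^ 2 * ‖genFun A (z x ^ j)‖ ^ k := fun j hj =>
    (hhc.pow 2).mul ((continuous_genFun_circle A hr hr1 hj).norm.pow k)
  have hil : ∀ l ∈ Finset.Icc 1 k, i * l ≠ 0 := fun l hl =>
    mul_ne_zero hi (by have := Finset.mem_Icc.1 hl; omega)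
  have hpt : ∀ x, h x ^ 2 * ‖genFun A (z x ^ i)‖ ^ k ≤
      k.factorial * (c * M ^ 2 * (1 / ‖1 - z x ^ i‖) +
        i * (lam * h x ^ 2 + ‖seqGen s (z x ^ i)‖ ^ 2 / lam)) +
      θ * ∑ l ∈ Finset.Icc 1 k, h x ^ 2 * ‖genFun A (z x ^ (i * l))‖ ^ k + D * h x ^ 2 := by
    intro x
    have h1 := mul_le_mul_of_nonneg_left (hf (z x ^ i) (hzi x)) (sq_nonneg (h x))
    simp only [← pow_mul] at h1
    have h2 : h x ^ 2 * ‖G (z x ^ i)‖ ≤ c * M ^ 2 * (1 / ‖1 - z x ^ i‖) +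
        i * (lam * h x ^ 2 + ‖seqGen s (z x ^ i)‖ ^ 2 / lam) := by
      rw [hG _ (hzi x)]
      have h3 : ‖(c : ℂ) / (1 - z x ^ i) + (1 - z x ^ i) * seqGen s (z x ^ i)‖ ≤
          c * (1 / ‖1 - z x ^ i‖) + ‖1 - z x ^ i‖ * ‖seqGen s (z x ^ i)‖ := by
        refine (norm_add_le _ _).trans ?_
        rw [norm_div, norm_mul, Complex.norm_real, Real.norm_of_nonneg hc, mul_one_div]
      have h4 : h x ≤ M := norm_geomSum_le (by rw [hzn]; exact hr1.le) M
      have h5 : h x * ‖1 - z x ^ i‖ ≤ 2 * i :=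
        norm_geomSum_mul_one_sub_pow_le (by rw [hzn]; exact hr1.le) M i
      have h0 : 0 ≤ h x := norm_nonneg _
      have h6 : h x ^ 2 ≤ (M : ℝ) ^ 2 := pow_le_pow_left₀ h0 h4 2
      set S := ‖seqGen s (z x ^ i)‖ with hS
      have hS0 : 0 ≤ S := norm_nonneg _
      have h7 : 2 * (h x * S) ≤ lam * h x ^ 2 + S ^ 2 / lam := by
        have e1 : lam * h x ^ 2 + S ^ 2 / lam - 2 * (h x * S) = (lam * h x - S) ^ 2 / lam := by
          field_simp
          ring
        have e2 : 0 ≤ (lam * h x - S) ^ 2 / lam := by positivity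
        linarith
      calc _ ≤ h x ^ 2 * (c * (1 / ‖1 - z x ^ i‖) + ‖1 - z x ^ i‖ * S) := by gcongr
        _ = c * h x ^ 2 * (1 / ‖1 - z x ^ i‖) + (h x * ‖1 - z x ^ i‖) * (h x * S) := by ring
        _ ≤ c * M ^ 2 * (1 / ‖1 - z x ^ i‖) + 2 * i * (h x * S) := by gcongr
        _ = c * M ^ 2 * (1 / ‖1 - z x ^ i‖) + i * (2 * (h x * S)) := by ring
        _ ≤ _ := by gcongr
    have h8 := mul_le_mul_of_nonneg_left h2 (Nat.cast_nonneg (α := ℝ) k.factorial)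
    rw [← Finset.mul_sum]
    linarith
  have hs1 : Continuous fun x => ∑ l ∈ Finset.Icc 1 k, h x ^ 2 * ‖genFun A (z x ^ (i * l))‖ ^ k :=
    continuous_finsetSum _ fun l hl => hc3 _ (hil l hl)
  have hI := MeasureTheory.integral_mono (μ := circleMeasure)
    (integrable_of_continuous (hc3 i hi)) (integrable_of_continuous (by fun_prop)) hpt
  refine hI.trans ?_
  rw [MeasureTheory.integral_add (integrable_of_continuous (by fun_prop))
      (integrable_of_continuous (by fun_prop)),
    MeasureTheory.integral_add (integrable_of_continuous (by fun_prop))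
      (integrable_of_continuous (by fun_prop)),
    MeasureTheory.integral_const_mul, MeasureTheory.integral_const_mul,
    MeasureTheory.integral_const_mul,
    MeasureTheory.integral_add (integrable_of_continuous (by fun_prop))
      (integrable_of_continuous (by fun_prop)),
    MeasureTheory.integral_const_mul, MeasureTheory.integral_const_mul,
    MeasureTheory.integral_add (integrable_of_continuous (by fun_prop))
      (integrable_of_continuous (by fun_prop)),
    MeasureTheory.integral_const_mul, MeasureTheory.integral_div,
    MeasureTheory.integral_finsetSum _ fun l hl => integrable_of_continuous (hc3 _ (hil l hl))]
  have b1 := integral_inv_norm_one_sub_pow_le hr hr1 hi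
  have b2 := integral_norm_geomSum_sq_le hr hr1.le M
  have b3 := integral_norm_seqGen_sq_le hK hr hr1 hQ hi
  simp only [kernelMean]
  gcongr

/-- Iterating the step preserves the bound 2iE: the k terms with l ≤ k contribute at most
k·(2ikE)/(2k²) = iE. The a priori bound B is at least halved each time and disappears in the limit.
-/
theorem kernelMean_le_of_step {A : Set ℕ} {k M : ℕ} (hk : 1 ≤ k) {E : ℝ} (hE : 0 ≤ E)
    {r : ℝ} (hr : 0 ≤ r) (hr1 : r < 1)
    (hstep : ∀ i : ℕ, i ≠ 0 → kernelMean A k M r i ≤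
      i * E + 1 / (2 * k ^ 2) * ∑ l ∈ Finset.Icc 1 k, kernelMean A k M r (i * l)) :
    kernelMean A k M r 1 ≤ 2 * E := by
  have hk0 : (1 : ℝ) ≤ k := by exact_mod_cast hk
  -- Uniformity in i holds because |z^i| ≤ r for every i ≥ 1.
  obtain ⟨B, hB0, hB⟩ : ∃ B : ℝ, 0 ≤ B ∧ ∀ i : ℕ, i ≠ 0 → kernelMean A k M r i ≤ B := by
    refine ⟨M ^ 2 * (∑' n : ℕ, r ^ n) ^ k,
      mul_nonneg (by positivity) (pow_nonneg (tsum_nonneg fun n => by positivity) k),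
      fun i hi => ?_⟩
    have hpt : ∀ x, ‖∑ j ∈ Finset.range M, ((r : ℂ) * unitExp x) ^ j‖ ^ 2 *
        ‖genFun A (((r : ℂ) * unitExp x) ^ i)‖ ^ k ≤ M ^ 2 * (∑' n : ℕ, r ^ n) ^ k := by
      intro x
      have hzn := norm_mul_unitExp hr x
      have hzi : ‖((r : ℂ) * unitExp x) ^ i‖ ≤ r := by
        rw [norm_pow, hzn]
        exact pow_le_of_le_one hr hr1.le hi
      gcongr
      · exact norm_geomSum_le (by rw [hzn]; exact hr1.le) M
      · refine tsum_of_norm_bounded (summable_geometric_of_lt_one hr hr1).hasSum fun n => ?_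
        exact (norm_term_le _ _ _).trans (pow_le_pow_left₀ (norm_nonneg _) hzi n)
    refine (MeasureTheory.integral_mono (μ := circleMeasure) (integrable_of_continuous
      (Continuous.mul (by fun_prop) ((continuous_genFun_circle A hr hr1 hi).norm.pow k)))
      (MeasureTheory.integrable_const _) hpt).trans ?_
    simp
  have hind : ∀ n i : ℕ, i ≠ 0 → kernelMean A k M r i ≤ i * (2 * E) + (1 / 2) ^ n * B := by
    intro n
    induction n with
    | zero =>
      intro i hi
      have : 0 ≤ (i : ℝ) * (2 * E) := by positivity
      have := hB i hi
      simp
      linarith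
    | succ n ih =>
      intro i hi
      refine (hstep i hi).trans ?_
      have h1 : ∑ l ∈ Finset.Icc 1 k, kernelMean A k M r (i * l) ≤
          k * (i * k * (2 * E) + (1 / 2) ^ n * B) := by
        refine (Finset.sum_le_card_nsmul _ _ (i * k * (2 * E) + (1 / 2) ^ n * B)
          fun l hl => ?_).trans ?_
        · rw [Finset.mem_Icc] at hl
          refine (ih (i * l) (mul_ne_zero hi (by omega))).trans ?_
          have : (l : ℝ) ≤ k := by exact_mod_cast hl.2
          push_cast
          gcongr
        · rw [Nat.card_Icc, Nat.add_sub_cancel, nsmul_eq_mul]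
      have h2 : 1 / (2 * (k : ℝ) ^ 2) * ∑ l ∈ Finset.Icc 1 k, kernelMean A k M r (i * l) ≤
          i * E + (1 / 2) ^ (n + 1) * B := by
        calc _ ≤ 1 / (2 * (k : ℝ) ^ 2) * (k * (i * k * (2 * E) + (1 / 2) ^ n * B)) := by gcongr
          _ = i * E + 1 / k * ((1 / 2) ^ (n + 1) * B) := by
            field_simp
            ring
          _ ≤ i * E + 1 * ((1 / 2) ^ (n + 1) * B) := by
            gcongr
            rw [div_le_one (by linarith)]
            exact hk0
          _ = _ := by ring
      linarith
  have hlim : Tendsto (fun n : ℕ => (1 : ℝ) * (2 * E) + (1 / 2) ^ n * B) atTop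
      (nhds (1 * (2 * E) + 0 * B)) :=
    ((tendsto_pow_atTop_nhds_zero_of_lt_one (by norm_num) (by norm_num)).mul_const B).const_add _
  have := ge_of_tendsto' hlim fun n => by simpa using hind n 1 one_ne_zero
  linarith

/-! ### Lower bound for the weighted mean -/

/-- The arithmetic input: window counts are natural numbers, so v ≤ v². The right side is Σ v²r^(2m)
by Parseval, the left side Σ v·r^(2m). -/
theorem norm_geomSum_mul_genFun_le {A : Set ℕ} {r : ℝ} (hr : 0 ≤ r) (hr1 : r < 1) (M : ℕ) :
    ‖(∑ j ∈ Finset.range M, ((r ^ 2 : ℝ) : ℂ) ^ j) * genFun A ((r ^ 2 : ℝ) : ℂ)‖ ≤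
      ∫ x, ‖∑ j ∈ Finset.range M, ((r : ℂ) * unitExp x) ^ j‖ ^ 2 *
        ‖genFun A ((r : ℂ) * unitExp x)‖ ^ 2 ∂circleMeasure := by
  have hr2 : r ^ 2 < 1 := pow_lt_one₀ hr hr1 two_ne_zero
  have hrn : ‖((r : ℝ) : ℂ)‖ = r := by rw [Complex.norm_real, Real.norm_of_nonneg hr]
  have hrn2 : ‖((r ^ 2 : ℝ) : ℂ)‖ = r ^ 2 := by
    rw [Complex.norm_real, Real.norm_of_nonneg (by positivity)]
  have h1 := hasSum_windowCount A M (z := ((r ^ 2 : ℝ) : ℂ)) (by rwa [hrn2])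
  have h2 : Summable fun m => ‖(windowCount A M m : ℂ) * (r : ℂ) ^ m‖ := by
    refine (hasSum_windowCount A M (z := (r : ℂ)) (by rwa [hrn])).summable.norm
  have h3 := integral_norm_sq_tsum h2
  have e : ∀ x, ‖∑' m, (windowCount A M m : ℂ) * (r : ℂ) ^ m * unitExp x ^ m‖ ^ 2 =
      ‖∑ j ∈ Finset.range M, ((r : ℂ) * unitExp x) ^ j‖ ^ 2 *
        ‖genFun A ((r : ℂ) * unitExp x)‖ ^ 2 := fun x => by
    rw [← mul_pow, ← norm_mul,
      ← (hasSum_windowCount A M (z := (r : ℂ) * unitExp x) (by rwa [norm_mul_unitExp hr])).tsum_eq]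
    simp only [mul_pow, mul_assoc]
  simp only [e] at h3
  have h4 : ∀ m, ‖(windowCount A M m : ℂ) * ((r ^ 2 : ℝ) : ℂ) ^ m‖ ≤
      ‖(windowCount A M m : ℂ) * (r : ℂ) ^ m‖ ^ 2 := fun m => by
    rw [norm_mul, norm_mul, norm_pow, norm_pow, hrn, hrn2, Complex.norm_natCast, mul_pow,
      ← pow_mul, ← pow_mul, mul_comm m 2]
    refine mul_le_mul_of_nonneg_right ?_ (by positivity)
    exact_mod_cast Nat.le_self_pow two_ne_zero _
  rw [← h1.tsum_eq, ← h3.tsum_eq]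
  exact tsum_of_norm_bounded h3.summable.hasSum h4

/-- Integrate L^(k-2)·y² ≤ y^k + L^k with y = |f| against the kernel. With the normalization 4L² the
left side is at least 2L^k·M, while the L^k term costs at most L^k·M. -/
theorem pow_mul_le_kernelMean {A : Set ℕ} {k : ℕ} (hk : 2 ≤ k) {r : ℝ} (hr : 0 ≤ r) (hr1 : r < 1)
    {M : ℕ} {L : ℝ} (hL : 0 ≤ L) (hLf : ‖genFun A ((r ^ 2 : ℝ) : ℂ)‖ = 4 * L ^ 2)
    (hM : (M : ℝ) / 2 ≤ ∑ j ∈ Finset.range M, (r ^ 2) ^ j) :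
    L ^ k * M ≤ kernelMean A k M r 1 := by
  have h1 := norm_geomSum_mul_genFun_le (A := A) hr hr1 M
  have hg : ‖∑ j ∈ Finset.range M, ((r ^ 2 : ℝ) : ℂ) ^ j‖ = ∑ j ∈ Finset.range M, (r ^ 2) ^ j := by
    have : ∑ j ∈ Finset.range M, ((r ^ 2 : ℝ) : ℂ) ^ j
        = ((∑ j ∈ Finset.range M, (r ^ 2) ^ j : ℝ) : ℂ) := by push_cast; rfl
    rw [this, Complex.norm_real, Real.norm_of_nonneg (by positivity)]
  rw [norm_mul, hg, hLf] at h1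
  obtain ⟨j, rfl⟩ : ∃ j, k = j + 2 := ⟨k - 2, by omega⟩
  have hy : ∀ y : ℝ, 0 ≤ y → L ^ j * y ^ 2 ≤ y ^ (j + 2) + L ^ (j + 2) := by
    intro y hy
    rw [pow_add, pow_add]
    have h1 : 0 ≤ L ^ j * L ^ 2 := by positivity
    have h2 : 0 ≤ y ^ j * y ^ 2 := by positivity
    rcases le_total y L with h | h
    · have : L ^ j * y ^ 2 ≤ L ^ j * L ^ 2 := by gcongr
      linarith
    · have : L ^ j * y ^ 2 ≤ y ^ j * y ^ 2 := by gcongr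
      linarith
  have hcf : Continuous fun x => genFun A ((r : ℂ) * unitExp x) := by
    simpa using continuous_genFun_circle A hr hr1 one_ne_zero
  have h2 := MeasureTheory.integral_mono (μ := circleMeasure)
    (f := fun x => L ^ j * (‖∑ j ∈ Finset.range M, ((r : ℂ) * unitExp x) ^ j‖ ^ 2 *
        ‖genFun A ((r : ℂ) * unitExp x)‖ ^ 2))
    (g := fun x => ‖∑ j ∈ Finset.range M, ((r : ℂ) * unitExp x) ^ j‖ ^ 2 *
        ‖genFun A ((r : ℂ) * unitExp x)‖ ^ (j + 2) +
        L ^ (j + 2) * ‖∑ j ∈ Finset.range M, ((r : ℂ) * unitExp x) ^ j‖ ^ 2)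
    (integrable_of_continuous (by fun_prop)) (integrable_of_continuous (by fun_prop)) fun x => by
      have := mul_le_mul_of_nonneg_left (hy _ (norm_nonneg (genFun A ((r : ℂ) * unitExp x))))
        (sq_nonneg ‖∑ j ∈ Finset.range M, ((r : ℂ) * unitExp x) ^ j‖)
      beta_reduce
      linarith
  rw [MeasureTheory.integral_const_mul, MeasureTheory.integral_add
    (integrable_of_continuous (by fun_prop)) (integrable_of_continuous (by fun_prop)),
    MeasureTheory.integral_const_mul] at h2
  have h3 := integral_norm_geomSum_sq_le hr hr1.le M
  have h4 : L ^ j * ((M : ℝ) / 2 * (4 * L ^ 2)) ≤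
      L ^ j * ∫ x, ‖∑ j ∈ Finset.range M, ((r : ℂ) * unitExp x) ^ j‖ ^ 2 *
        ‖genFun A ((r : ℂ) * unitExp x)‖ ^ 2 ∂circleMeasure := by
    refine mul_le_mul_of_nonneg_left (le_trans ?_ h1) (by positivity)
    gcongr
  have h5 : L ^ (j + 2) * ∫ x, ‖∑ j ∈ Finset.range M, ((r : ℂ) * unitExp x) ^ j‖ ^ 2 ∂circleMeasure
      ≤ L ^ (j + 2) * M := by gcongr
  simp only [kernelMean, pow_one]
  rw [pow_add] at *
  linarith

/-! ### Consequences of the little-o hypothesis -/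

section
variable {s : ℕ → ℝ}

theorem sq_le_of_isLittleO
    (h : s =o[atTop] fun n : ℕ => (n : ℝ) ^ (1 / 4 : ℝ) * (Real.log (n : ℝ)) ^ (-(1 / 2) : ℝ))
    {ε : ℝ} (hε : 0 < ε) : ∀ᶠ n : ℕ in atTop, s n ^ 2 ≤ ε * (Real.sqrt n / Real.log n) := by
  filter_upwards [h.bound (Real.sqrt_pos.2 hε), eventually_gt_atTop 1] with n hn hn1
  have hlog : 0 < Real.log n := Real.log_pos (by exact_mod_cast hn1)
  have h1 := pow_le_pow_left₀ (norm_nonneg _) hn 2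
  rw [mul_pow, Real.sq_sqrt hε.le, norm_mul, mul_pow, Real.norm_eq_abs, Real.norm_eq_abs,
    Real.norm_eq_abs, sq_abs, sq_abs, sq_abs, ← Real.rpow_natCast, ← Real.rpow_natCast,
    ← Real.rpow_natCast, ← Real.rpow_mul (by positivity), ← Real.rpow_mul hlog.le] at h1
  norm_num at h1
  rw [Real.rpow_neg_one] at h1
  rwa [Real.sqrt_eq_rpow, div_eq_mul_inv]

theorem exists_sq_le_of_isLittleO
    (h : s =o[atTop] fun n : ℕ => (n : ℝ) ^ (1 / 4 : ℝ) * (Real.log (n : ℝ)) ^ (-(1 / 2) : ℝ)) :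
    ∃ K : ℝ, 0 ≤ K ∧ ∀ n, s n ^ 2 ≤ K * (n + 1) := by
  obtain ⟨n0, hn0⟩ := eventually_atTop.1 ((sq_le_of_isLittleO h one_pos).and
    ((Real.tendsto_log_atTop.comp tendsto_natCast_atTop_atTop).eventually_ge_atTop 1))
  have hS : 0 ≤ ∑ n ∈ Finset.range n0, s n ^ 2 := Finset.sum_nonneg fun _ _ => sq_nonneg _
  refine ⟨1 + ∑ n ∈ Finset.range n0, s n ^ 2, by linarith, fun n => ?_⟩
  have hn : (0 : ℝ) ≤ n := n.cast_nonneg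
  rcases lt_or_ge n n0 with h1 | h1
  · have := Finset.single_le_sum (f := fun n => s n ^ 2) (fun _ _ => sq_nonneg _)
      (Finset.mem_range.2 h1)
    nlinarith
  · obtain ⟨h2, h3⟩ := hn0 n h1
    simp only [Function.comp] at h3
    have h4 : Real.sqrt n / Real.log n ≤ Real.sqrt n := div_le_self (Real.sqrt_nonneg _) h3
    have h5 : Real.sqrt n ≤ n + 1 := by
      rw [Real.sqrt_le_left (by linarith)]
      nlinarith
    nlinarith

theorem abs_le_of_sq_le {K : ℝ} (hK : ∀ n, s n ^ 2 ≤ K * (n + 1)) (n : ℕ) :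
    |s n| ≤ (1 + K) * (n + 1) := by
  have h1 := hK n
  have hn : (0 : ℝ) ≤ n := n.cast_nonneg
  rw [← sq_abs] at h1
  nlinarith [abs_nonneg (s n), sq_nonneg (|s n| - 1)]

theorem summable_sq_mul_pow {K : ℝ} (hK : ∀ n, s n ^ 2 ≤ K * (n + 1)) {x : ℝ} (hx : 0 ≤ x)
    (hx1 : x < 1) : Summable fun n => s n ^ 2 * x ^ n := by
  have := summable_of_linear_bound (a := fun n => ((s n ^ 2 : ℝ) : ℂ)) (K := K) (r := x)
    (fun n => by rw [Complex.norm_real, Real.norm_of_nonneg (sq_nonneg _)]; exact hK n) hx hx1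
  refine this.congr fun n => ?_
  rw [Complex.norm_real, Real.norm_of_nonneg (sq_nonneg _)]

/-- Below m the crude linear bound suffices. From m on, log n ≥ log m and √n ≤ m² + n/m², which is
linear in n and balanced at n = m^4. The series Σx^n ≤ m^4 and Σn·x^n ≤ m^8 finish the estimate. -/
theorem tsum_sq_mul_pow_le {K ε : ℝ} {m : ℕ} (hm : 2 ≤ m) (hK0 : 0 ≤ K) (hε : 0 ≤ ε)
    (hK : ∀ n, s n ^ 2 ≤ K * (n + 1))
    (hm' : ∀ n ≥ m, s n ^ 2 ≤ ε * (Real.sqrt n / Real.log n)) {x : ℝ} (hx : 0 ≤ x)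
    (hx1 : 1 / (m : ℝ) ^ 4 ≤ 1 - x) :
    ∑' n, s n ^ 2 * x ^ n ≤ 2 * K * m ^ 5 + 2 * ε * (m ^ 6 / Real.log m) := by
  have hm0 : (2 : ℝ) ≤ m := by exact_mod_cast hm
  have hm4 : (0 : ℝ) < 1 / (m : ℝ) ^ 4 := by positivity
  have hx2 : x < 1 := by linarith
  have hlog : 0 < Real.log m := Real.log_pos (by linarith)
  have hinv : (1 - x)⁻¹ ≤ (m : ℝ) ^ 4 := by
    rw [inv_le_comm₀ (by linarith) (by positivity)]
    simpa using hx1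
  have hg := hasSum_geometric_of_lt_one hx hx2
  have hg2 := hasSum_coe_mul_geometric_of_norm_lt_one (r := x) (by rwa [Real.norm_of_nonneg hx])
  have hbd := (hg.mul_left (2 * K * m + ε / Real.log m * m ^ 2)).add
    (hg2.mul_left (ε / Real.log m / m ^ 2))
  have hpt : ∀ n, s n ^ 2 * x ^ n ≤ (2 * K * m + ε / Real.log m * m ^ 2) * x ^ n +
      ε / Real.log m / m ^ 2 * (n * x ^ n) := by
    intro n
    have hn : (0 : ℝ) ≤ n := n.cast_nonneg
    have h0 : s n ^ 2 ≤ 2 * K * m + ε / Real.log m * m ^ 2 + ε / Real.log m / m ^ 2 * n := by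
      have p1 : 0 ≤ ε / Real.log m * m ^ 2 := by positivity
      have p2 : 0 ≤ ε / Real.log m / m ^ 2 * n := by positivity
      have p3 : 0 ≤ 2 * K * m := by positivity
      rcases lt_or_ge n m with h | h
      · have h1 : (n : ℝ) + 1 ≤ 2 * m := by
          have : (n : ℝ) + 1 ≤ m := by exact_mod_cast h
          linarith
        have := mul_le_mul_of_nonneg_left h1 hK0
        linarith [hK n]
      · have h1 : (m : ℝ) ≤ n := by exact_mod_cast h
        have h2 : Real.log m ≤ Real.log n := Real.log_le_log (by linarith) h1
        have h3 : Real.sqrt n ≤ m ^ 2 + n / m ^ 2 := by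
          have h5 := Real.sq_sqrt hn
          have h6 := sq_nonneg (Real.sqrt n - m ^ 2)
          have h7 : (m : ℝ) ^ 2 + n / m ^ 2 - Real.sqrt n =
              ((Real.sqrt n - m ^ 2) ^ 2 + Real.sqrt n * m ^ 2) / m ^ 2 := by
            field_simp
            linear_combination -h5
          have h8 : 0 ≤ ((Real.sqrt n - m ^ 2) ^ 2 + Real.sqrt n * m ^ 2) / (m : ℝ) ^ 2 := by
            positivity
          linarith
        have h4 : s n ^ 2 ≤ ε / Real.log m * (m ^ 2 + n / m ^ 2) := by
          refine (hm' n h).trans ?_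
          rw [div_mul_eq_mul_div, ← mul_div_assoc]
          gcongr
        have e : ε / Real.log m * (m ^ 2 + n / m ^ 2) =
            ε / Real.log m * m ^ 2 + ε / Real.log m / m ^ 2 * n := by ring
        linarith
    have := mul_le_mul_of_nonneg_right h0 (pow_nonneg hx n)
    linarith
  have h1 := hasSum_le hpt (summable_sq_mul_pow hK hx hx2).hasSum hbd
  refine h1.trans ?_
  have h2 : x / (1 - x) ^ 2 ≤ (m : ℝ) ^ 8 := by
    have : x / (1 - x) ^ 2 = x * ((1 - x)⁻¹) ^ 2 := by field_simp
    rw [this]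
    have h3 : ((1 - x)⁻¹) ^ 2 ≤ ((m : ℝ) ^ 4) ^ 2 :=
      pow_le_pow_left₀ (inv_nonneg.2 (by linarith)) hinv 2
    nlinarith [sq_nonneg ((1 - x)⁻¹)]
  calc _ ≤ (2 * K * m + ε / Real.log m * m ^ 2) * m ^ 4 + ε / Real.log m / m ^ 2 * m ^ 8 := by
        gcongr
    _ = _ := by
        field_simp
        ring

/-- Uses |s| ≤ 1 + s², so that the one quadratic sum already estimated also controls S on the real
axis. -/
theorem norm_seqGen_le {K : ℝ} (hK : ∀ n, s n ^ 2 ≤ K * (n + 1)) {x : ℝ} (hx : 0 ≤ x)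
    (hx1 : x < 1) : ‖seqGen s x‖ ≤ (1 - x)⁻¹ + ∑' n, s n ^ 2 * x ^ n := by
  refine tsum_of_norm_bounded ((hasSum_geometric_of_lt_one hx hx1).add
    (summable_sq_mul_pow hK hx hx1).hasSum) fun n => ?_
  rw [norm_mul, norm_pow, Complex.norm_real, Complex.norm_real, Real.norm_of_nonneg hx,
    Real.norm_eq_abs, ← one_add_mul]
  refine mul_le_mul_of_nonneg_right ?_ (pow_nonneg hx n)
  rw [← sq_abs]
  nlinarith [sq_nonneg (|s n| - 1), abs_nonneg (s n)]

end

/-! ### Choice of parameters and the contradiction -/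

/-- By Bernoulli each term is at least 1 - 2j/N ≥ 1/2. -/
theorem half_le_sum_pow {N : ℝ} (hN : 1 ≤ N) {M : ℕ} (hM : (M : ℝ) ≤ N / 4) :
    (M : ℝ) / 2 ≤ ∑ j ∈ Finset.range M, ((1 - 1 / N) ^ 2) ^ j := by
  have h1 : ∀ j ∈ Finset.range M, (1 / 2 : ℝ) ≤ ((1 - 1 / N) ^ 2) ^ j := by
    intro j hj
    have hj' : (j : ℝ) ≤ M := by exact_mod_cast (Finset.mem_range.1 hj).le
    have hN1 : 1 / N ≤ 1 := by rw [div_le_one (by linarith)]; exact hN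
    have h2 := one_add_mul_le_pow (a := -(1 / N)) (by linarith) (2 * j)
    rw [← pow_mul, sub_eq_add_neg]
    refine le_trans ?_ h2
    have h3 : (j : ℝ) / N ≤ 1 / 4 := by
      rw [div_le_iff₀ (by linarith)]
      linarith
    have h4 : ((2 * j : ℕ) : ℝ) * -(1 / N) = -(2 * (j / N)) := by
      push_cast
      ring
    rw [h4]
    linarith
  have := Finset.card_nsmul_le_sum _ _ _ h1
  rw [Finset.card_range, nsmul_eq_mul] at this
  linarith

/-- The pole contributes at least c·m^4/2, while (1 - x)S(x) is only O(m²). -/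
theorem mul_le_norm_repGen {G : ℂ → ℂ} {s : ℕ → ℝ} {c K ε : ℝ} (hc : 0 < c)
    (hK : ∀ n, s n ^ 2 ≤ K * (n + 1)) (hε : 0 ≤ ε)
    (hG : ∀ z : ℂ, ‖z‖ < 1 → G z = c / (1 - z) + (1 - z) * seqGen s z)
    {m x : ℝ} (hm : 1 ≤ m) (hx : 0 ≤ x) (hx1 : 1 - x ≤ 2 / m ^ 4) (hx2 : x < 1)
    (hQ : ∑' n, s n ^ 2 * x ^ n ≤ 3 * ε * m ^ 6) (hmc : 4 * (1 + 6 * ε) / c ≤ m) :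
    c * m ^ 4 / 4 ≤ ‖G x‖ := by
  have hxn : ‖(x : ℂ)‖ = x := by rw [Complex.norm_real, Real.norm_of_nonneg hx]
  rw [hG x (by rwa [hxn])]
  have hx3 : 0 < 1 - x := by linarith
  have e1 : ‖(1 : ℂ) - x‖ = 1 - x := by
    rw [← Complex.ofReal_one, ← Complex.ofReal_sub, Complex.norm_real, Real.norm_of_nonneg hx3.le]
  have h1 : ‖(c : ℂ) / (1 - x)‖ = c / (1 - x) := by
    rw [norm_div, e1, Complex.norm_real, Real.norm_of_nonneg hc.le]
  have h2 : c * m ^ 4 / 2 ≤ c / (1 - x) := by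
    rw [le_div_iff₀ hx3]
    calc c * m ^ 4 / 2 * (1 - x) ≤ c * m ^ 4 / 2 * (2 / m ^ 4) := by gcongr
      _ = c := by field_simp
  have h3 : ‖(1 - (x : ℂ)) * seqGen s x‖ ≤ 1 + 6 * ε * m ^ 2 := by
    rw [norm_mul, e1]
    have h4 := norm_seqGen_le hK hx hx2
    calc (1 - x) * ‖seqGen s x‖ ≤ (1 - x) * ((1 - x)⁻¹ + 3 * ε * m ^ 6) := by gcongr; linarith
      _ = 1 + (1 - x) * (3 * ε * m ^ 6) := by rw [mul_add, mul_inv_cancel₀ hx3.ne']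
      _ ≤ 1 + 2 / m ^ 4 * (3 * ε * m ^ 6) := by gcongr
      _ = _ := by field_simp; ring
  have h5 : 1 + 6 * ε * m ^ 2 ≤ c * m ^ 4 / 4 := by
    rw [div_le_iff₀ hc] at hmc
    have hm2 : 1 ≤ m ^ 2 := one_le_pow₀ hm
    have hm3 : m ≤ m ^ 2 := le_self_pow₀ hm two_ne_zero
    have h6 : (1 + 6 * ε) * m ^ 2 ≤ m ^ 2 * c / 4 * m ^ 2 := by
      gcongr
      have : m * c ≤ m ^ 2 * c := by gcongr
      linarith
    nlinarith
  have h7 := norm_sub_le_norm_add ((c : ℂ) / (1 - x)) ((1 - (x : ℂ)) * seqGen s x)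
  rw [h1] at h7
  linarith

theorem eventually_log_le_mul {η : ℝ} (hη : 0 < η) :
    ∀ᶠ m : ℕ in atTop, Real.log m ≤ η * m := by
  filter_upwards [(Real.isLittleO_log_id_atTop.comp_tendsto tendsto_natCast_atTop_atTop).bound hη]
    with m hm
  simp only [Function.comp, id, Real.norm_eq_abs, Nat.abs_cast] at hm
  exact (le_abs_self _).trans hm

theorem kernelMean_le {A : Set ℕ} {k M : ℕ} {c K D : ℝ} {G : ℂ → ℂ} {s : ℕ → ℝ}
    (hk : 1 ≤ k) (hc : 0 ≤ c) (hD : 0 ≤ D) (hK : ∀ n, |s n| ≤ K * (n + 1))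
    (hG : ∀ z : ℂ, ‖z‖ < 1 → G z = c / (1 - z) + (1 - z) * seqGen s z)
    (hf : ∀ z : ℂ, ‖z‖ < 1 → ‖genFun A z‖ ^ k ≤ k.factorial * ‖G z‖ +
      1 / (2 * (k : ℝ) ^ 2) * ∑ l ∈ Finset.Icc 1 k, ‖genFun A (z ^ l)‖ ^ k + D)
    {r Q lam Λ : ℝ} (hr : 0 ≤ r) (hr1 : r < 1) (hlam : 0 < lam)
    (hQ : HasSum (fun n => s n ^ 2 * (r ^ 2) ^ n) Q)
    (hΛ0 : 0 ≤ Λ) (hΛ : 2 * Real.log ((2 - r) / (1 - r)) ≤ Λ) :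
    kernelMean A k M r 1 ≤
      2 * ((k.factorial * (c + 1) + D) * (M ^ 2 * Λ + (lam * M + Q / lam) + M)) := by
  have hQ0 : 0 ≤ Q := hQ.nonneg fun n => by positivity
  set a : ℝ := M ^ 2 * Λ with ha
  set b : ℝ := lam * M + Q / lam with hb
  have ha0 : 0 ≤ a := by positivity
  have hb0 : 0 ≤ b := by positivity
  refine kernelMean_le_of_step hk (by positivity) hr hr1 fun i hi => ?_
  have h1 := kernelMean_le_step (M := M) hc hD hK hG hf hr hr1 hlam hQ hi
  have hi1 : (1 : ℝ) ≤ i := by exact_mod_cast Nat.one_le_iff_ne_zero.2 hi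
  have h2 : k.factorial * (c * M ^ 2 * (2 * Real.log ((2 - r) / (1 - r))) + i * b) + D * M ≤
      i * ((k.factorial * (c + 1) + D) * (a + b + M)) := by
    have h3 : c * M ^ 2 * (2 * Real.log ((2 - r) / (1 - r))) ≤ c * a := by
      have := mul_le_mul_of_nonneg_left hΛ (by positivity : 0 ≤ c * (M : ℝ) ^ 2)
      rw [ha]
      linarith
    have h4 : c * a ≤ i * (c * a) := le_mul_of_one_le_left (by positivity) hi1
    have h5 : D * M ≤ i * (D * M) := le_mul_of_one_le_left (by positivity) hi1
    calc _ ≤ k.factorial * (i * (c * a) + i * b) + i * (D * M) := by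
          refine add_le_add (mul_le_mul_of_nonneg_left ?_ (by positivity)) h5
          linarith
      _ = i * (k.factorial * (c * a + b) + D * M) := by ring
      _ ≤ _ := by
        gcongr
        have : 0 ≤ k.factorial * (a + c * b + (c + 1) * M) + D * (a + b) := by positivity
        linarith
  linarith

/-- The choice of parameters that makes the upper and lower bounds incompatible. -/
theorem parameters_incompatible {c1 C δ ε m M ℓ Q X : ℝ} (hc1 : 0 < c1) (hC : 0 < C)
    (hδ : δ = c1 / (88 * C)) (hε : ε = δ ^ 2 * c1 / (48 * C)) (hm : 2 ≤ m) (hℓ : 0 < ℓ)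
    (hmC : 8 * C / c1 ≤ m) (hM : 0 < M) (hMℓ : M * ℓ ≤ δ * m ^ 2) (hM2 : δ * m ^ 2 / ℓ / 2 ≤ M)
    (hQ : Q ≤ 3 * ε * (m ^ 6 / ℓ)) (hlow : c1 * m ^ 2 * M ≤ X)
    (hup : X ≤ 2 * (C * (M ^ 2 * (10 * ℓ) + (δ * m ^ 2 * M + Q / (δ * m ^ 2)) + M))) : False := by
  have hδ0 : 0 < δ := by rw [hδ]; positivity
  have hε0 : 0 < ε := by rw [hε]; positivity
  have hmm : m ≤ m ^ 2 := le_self_pow₀ (by linarith) two_ne_zero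
  -- The lower bound on M turns δm²/ℓ into at most 2M.
  have hQL : Q / (δ * m ^ 2) ≤ 6 * ε / δ ^ 2 * m ^ 2 * M := by
    have h1 : 3 * ε * (m ^ 6 / ℓ) / (δ * m ^ 2) = 6 * ε / δ ^ 2 * m ^ 2 * (δ * m ^ 2 / ℓ / 2) := by
      field_simp
      ring
    calc _ ≤ 3 * ε * (m ^ 6 / ℓ) / (δ * m ^ 2) := by gcongr
      _ = _ := h1
      _ ≤ _ := by gcongr
  have hfin : c1 * m ^ 2 * M ≤
      2 * C * (11 * δ * m ^ 2 + 6 * ε / δ ^ 2 * m ^ 2 + 1) * M := by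
    refine hlow.trans (hup.trans ?_)
    have h2 : M ^ 2 * (10 * ℓ) ≤ 10 * δ * m ^ 2 * M := by
      have := mul_le_mul_of_nonneg_left hMℓ (by positivity : (0 : ℝ) ≤ 10 * M)
      linarith
    have h3 : M ^ 2 * (10 * ℓ) + δ * m ^ 2 * M + Q / (δ * m ^ 2) + M ≤
        (11 * δ * m ^ 2 + 6 * ε / δ ^ 2 * m ^ 2 + 1) * M := by linarith
    have := mul_le_mul_of_nonneg_left h3 (by positivity : 0 ≤ 2 * C)
    linarith
  have hfin2 := le_of_mul_le_mul_right hfin hM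
  -- The constants 88 = 2·11·4 and 48 = 2·6·4 make the first two contributions exactly c1/4 each.
  -- With the third, the total is at most three quarters of c1·m².
  have e1 : 2 * C * (11 * δ) = c1 / 4 := by
    rw [hδ]
    field_simp
    norm_num
  have e2 : 2 * C * (6 * ε / δ ^ 2) = c1 / 4 := by
    rw [hε]
    field_simp
    norm_num
  have e3 : 2 * C ≤ c1 * m ^ 2 / 4 := by
    rw [div_le_iff₀ hc1] at hmC
    have := mul_le_mul_of_nonneg_left hmm hc1.le
    linarith
  have e4 : 2 * C * (11 * δ * m ^ 2 + 6 * ε / δ ^ 2 * m ^ 2 + 1) =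
      2 * C * (11 * δ) * m ^ 2 + 2 * C * (6 * ε / δ ^ 2) * m ^ 2 + 2 * C := by ring
  rw [e4, e1, e2] at hfin2
  have : 0 < c1 * m ^ 2 := by positivity
  linarith

theorem two_mul_log_le {m : ℝ} (hm : 2 ≤ m) :
    2 * Real.log ((2 - (1 - 1 / m ^ 4)) / (1 - (1 - 1 / m ^ 4))) ≤ 10 * Real.log m := by
  have e1 : (2 - (1 - 1 / m ^ 4)) / (1 - (1 - 1 / m ^ 4)) = m ^ 4 + 1 := by
    field_simp
    ring
  have e2 : Real.log (m ^ 5) = 5 * Real.log m := by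
    rw [Real.log_pow]
    norm_num
  have e3 : Real.log (m ^ 4 + 1) ≤ Real.log (m ^ 5) := by
    refine Real.log_le_log (by positivity) ?_
    have : 1 ≤ m ^ 4 := one_le_pow₀ (by linarith)
    rw [pow_succ _ 4]
    nlinarith
  rw [e1]
  linarith

/-- The error term of the summatory function of `repInc` cannot be `o(n^(1/4) log^(-1/2) n)`. -/
theorem not_isLittleO_repInc {e : ℕ} (he : e ≤ 1) {k : ℕ} (hk : 2 ≤ k) {c : ℝ} (hc : 0 < c)
    (A : Set ℕ)
    (h : (fun n : ℕ => ∑ j ∈ Finset.range (n + 1), ((repInc e k A j : ℝ) - c)) =o[atTop]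
      (fun n : ℕ => (n : ℝ) ^ (1 / 4 : ℝ) * (Real.log (n : ℝ)) ^ (-(1 / 2) : ℝ))) : False := by
  set s : ℕ → ℝ := fun n => ∑ j ∈ Finset.range (n + 1), ((repInc e k A j : ℝ) - c) with hs
  obtain ⟨K, hK0, hK⟩ := exists_sq_le_of_isLittleO h
  have hK1 := abs_le_of_sq_le hK
  have hsum : ∀ r : ℝ, 0 ≤ r → r < 1 → Summable fun n => (repInc e k A n : ℝ) * r ^ n :=
    fun r hr hr1 => summable_rep_of_partial_sum (s := s) (c := c) (fun _ => rfl) hK1 hr hr1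
  have hG : ∀ z : ℂ, ‖z‖ < 1 → repGen e k A z = c / (1 - z) + (1 - z) * seqGen s z := fun z hz => by
    have := hasSum_rep_of_partial_sum (s := s) (ρ := fun n => (repInc e k A n : ℝ)) (c := c)
      (fun _ => rfl) hK1 hz
    simpa [repGen] using this.tsum_eq
  have hkpos : (0 : ℝ) < k := by exact_mod_cast (by omega : 0 < k)
  obtain ⟨D, hD0, hD⟩ := norm_genFun_pow_le he (by omega : 1 ≤ k) A hsum
    (θ := 1 / (2 * (k : ℝ) ^ 2)) (by positivity)
  set C : ℝ := k.factorial * (c + 1) + D with hC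
  have hC0 : 0 < C := by positivity
  -- Chosen so that L^(2k) = |f(r²)|^k / 4^k ≥ (c·m^4/4) / 4^k yields L^k ≥ c1·m².
  set c1 : ℝ := Real.sqrt (c / 4 ^ (k + 1)) with hc1
  have hc10 : 0 < c1 := Real.sqrt_pos.2 (by positivity)
  set δ : ℝ := c1 / (88 * C) with hδ
  have hδ0 : 0 < δ := by positivity
  set ε : ℝ := δ ^ 2 * c1 / (48 * C) with hε
  have hε0 : 0 < ε := by positivity
  have hcast := tendsto_natCast_atTop_atTop (R := ℝ)
  obtain ⟨m, hm2, hsm, hlog1, hlog2, hlog3, hb1, hb2, hb3⟩ := ((eventually_ge_atTop 2).and <|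
    (eventually_forall_ge_atTop.2 (sq_le_of_isLittleO h hε0)).and <|
    ((Real.tendsto_log_atTop.comp hcast).eventually_ge_atTop 1).and <|
    (eventually_log_le_mul (η := ε / (2 * K + 1)) (by positivity)).and <|
    (eventually_log_le_mul (η := δ / 2) (by positivity)).and <|
    (hcast.eventually_ge_atTop (4 * δ)).and <|
    (hcast.eventually_ge_atTop (8 * C / c1)).and
    (hcast.eventually_gt_atTop (4 * (1 + 6 * ε) / c))).exists
  simp only [Function.comp] at hlog1
  have hm1 : (2 : ℝ) ≤ m := by exact_mod_cast hm2
  have hmm : (m : ℝ) ≤ m ^ 2 := le_self_pow₀ (by linarith) two_ne_zero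
  set ℓ := Real.log m with hℓ
  have hℓ0 : 0 < ℓ := by linarith
  -- Taking N = m^4 keeps N^(1/4) and N^(1/2) integral powers of m.
  set r : ℝ := 1 - 1 / (m : ℝ) ^ 4 with hr
  have hm4 : (1 : ℝ) ≤ (m : ℝ) ^ 4 := one_le_pow₀ (by linarith)
  have hNi : 0 < 1 / (m : ℝ) ^ 4 := by positivity
  have hNi1 : 1 / (m : ℝ) ^ 4 ≤ 1 := by rw [div_le_one (by linarith)]; exact hm4
  have hr0 : 0 ≤ r := by linarith
  have hr1 : r < 1 := by linarith
  have hx0 : 0 ≤ r ^ 2 := sq_nonneg r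
  have hx1 : r ^ 2 < 1 := pow_lt_one₀ hr0 hr1 two_ne_zero
  have hx2 : 1 / (m : ℝ) ^ 4 ≤ 1 - r ^ 2 := by nlinarith
  have hx3 : 1 - r ^ 2 ≤ 2 / (m : ℝ) ^ 4 := by
    rw [show (2 : ℝ) / (m : ℝ) ^ 4 = 2 * (1 / (m : ℝ) ^ 4) by ring]
    nlinarith
  set Q : ℝ := ∑' n, s n ^ 2 * (r ^ 2) ^ n with hQdef
  have hQs : HasSum (fun n => s n ^ 2 * (r ^ 2) ^ n) Q := (summable_sq_mul_pow hK hx0 hx1).hasSum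
  have hQ : Q ≤ 3 * ε * (m ^ 6 / ℓ) := by
    have h1 := tsum_sq_mul_pow_le hm2 hK0 hε0.le hK hsm hx0 hx2
    have h2 : 2 * K * (m : ℝ) ^ 5 ≤ ε * (m ^ 6 / ℓ) := by
      rw [← mul_div_assoc, le_div_iff₀ hℓ0]
      have h3 : 2 * K * ℓ ≤ ε * m := by
        rw [div_mul_eq_mul_div, le_div_iff₀ (by positivity)] at hlog2
        nlinarith
      have := mul_le_mul_of_nonneg_right h3 (by positivity : (0 : ℝ) ≤ (m : ℝ) ^ 5)
      linarith
    linarith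
  have hQ2 : Q ≤ 3 * ε * m ^ 6 := by
    refine hQ.trans ?_
    gcongr
    exact div_le_self (by positivity) hlog1
  -- About the largest M for which the pole's share M²ℓ is still at most δm²·M.
  set M : ℕ := ⌊δ * m ^ 2 / ℓ⌋₊ with hM
  have hM1 : (M : ℝ) ≤ δ * m ^ 2 / ℓ := Nat.floor_le (by positivity)
  have hM2 : δ * m ^ 2 / ℓ / 2 ≤ M := by
    have h1 : δ * m ^ 2 / ℓ < M + 1 := Nat.lt_floor_add_one _
    have h2 : 2 ≤ δ * m ^ 2 / ℓ := by
      rw [le_div_iff₀ hℓ0]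
      have := mul_le_mul_of_nonneg_left hmm hδ0.le
      linarith
    linarith
  have hM0 : (0 : ℝ) < M := lt_of_lt_of_le (by positivity) hM2
  have hMN : (M : ℝ) ≤ (m : ℝ) ^ 4 / 4 := by
    have h1 : δ * m ^ 2 / ℓ ≤ δ * m ^ 2 := div_le_self (by positivity) hlog1
    have h2 : 4 * δ * (m : ℝ) ^ 2 ≤ m ^ 2 * m ^ 2 := by gcongr; linarith
    linarith
  have hMℓ : M * ℓ ≤ δ * m ^ 2 := by rwa [le_div_iff₀ hℓ0] at hM1
  set L : ℝ := Real.sqrt (‖genFun A ((r ^ 2 : ℝ) : ℂ)‖ / 4) with hL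
  have hL2 : ‖genFun A ((r ^ 2 : ℝ) : ℂ)‖ = 4 * L ^ 2 := by
    rw [hL, Real.sq_sqrt (by positivity)]
    ring
  have hlow := pow_mul_le_kernelMean hk hr0 hr1 (Real.sqrt_nonneg _) hL2 (half_le_sum_pow hm4 hMN)
  have hLk : c1 * m ^ 2 ≤ L ^ k := by
    refine le_of_sq_le_sq ?_ (by positivity)
    have h1 := mul_le_norm_repGen hc hK hε0.le hG (by linarith) hx0 hx3 hx1 hQ2 hb3.le
    have h2 := norm_repGen_le e k A hx0 hx1 (hsum _ hx0 hx1)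
    rw [hL2, mul_pow] at h2
    rw [mul_pow, hc1, Real.sq_sqrt (by positivity),
      show ((m : ℝ) ^ 2) ^ 2 = m ^ 4 by ring, ← pow_mul L, mul_comm k 2, pow_mul L]
    rw [div_mul_eq_mul_div, div_le_iff₀ (by positivity), pow_succ 4 k]
    linarith
  have hup := kernelMean_le (M := M) (by omega : 1 ≤ k) hc.le hD0 hK1 hG hD hr0 hr1
    (lam := δ * m ^ 2) (by positivity) hQs (by positivity) (two_mul_log_le hm1)
  refine parameters_incompatible hc10 hC0 hδ hε hm1 hℓ0 hb2 hM0 hMℓ hM2 hQ ?_ hup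
  exact le_trans (by gcongr) hlow

theorem theorem1 (k : ℕ) (hk : 2 ≤ k) (c : ℝ) (hc : 0 < c) :
    (¬ ∃ A : Set ℕ,
      (fun n : ℕ => ∑ j ∈ Finset.range (n + 1), ((repLe k A j : ℝ) - c)) =o[atTop]
        (fun n : ℕ => (n : ℝ) ^ (1 / 4 : ℝ) * (Real.log (n : ℝ)) ^ (-(1 / 2) : ℝ))) ∧
    (¬ ∃ A : Set ℕ,
      (fun n : ℕ => ∑ j ∈ Finset.range (n + 1), ((repLt k A j : ℝ) - c)) =o[atTop]
        (fun n : ℕ => (n : ℝ) ^ (1 / 4 : ℝ) * (Real.log (n : ℝ)) ^ (-(1 / 2) : ℝ))) := by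
  refine ⟨?_, ?_⟩
  · rintro ⟨A, h⟩
    simp only [repLe_eq_repInc] at h
    exact not_isLittleO_repInc le_rfl hk hc A h
  · rintro ⟨A, h⟩
    simp only [repLt_eq_repInc] at h
    exact not_isLittleO_repInc zero_le_one hk hc A h
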